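/- Let $\mathbb K=\mathbb R$ or $\mathbb C$, and let all functions be $\mathbb K$-valued functions of $(x,t)\in\mathbb R^2$. Put $\partial_x^{-1}=\tfrac12\left(\int_{-\infty}^x-\int_x^\infty\right)\cdot\,dx$. The AKNS$(-1)$ system is $$q_{xt}-2q\,\partial_x^{-1}(qr)_t=q,\qquad r_{xt}-2r\,\partial_x^{-1}(qr)_t=r,\tag{1}$$ and its form with an auxiliary function $s$ is $$q_{xt}=2qs,\qquad r_{xt}=2rs,\qquad s_x=(qr)_t.\tag{2}$$ The nonpotential sine-Gordon equation (sG) is $q_{xt}-2qs=0$, $s_x+2qq_t=0$. The real nonlocal sG equation is $q_{xt}(x,t)-2q(x,t)s(x,t)=0$, $s_x(x,t)+[q(x,t)q(-x,-t)]_t=0$. Let $\sigma\in\{1,-1\}$. **(a) Reduction.** Let $q$ be $C^2$ on $\mathbb R^2$ and $r(x,t)=-q(\sigma x,\sigma t)$. * Suppose $(qr)_t(\cdot,t)$ is integrable on $\mathbb R$ for every $t$, and put $s=\partial_x^{-1}(qr)_t+\tfrac12$. Then for $\sigma=-1$ one has $s(-x,-t)=s(x,t)$. Moreover $(q,r)$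 solves (1) if and only if $(q,r,s)$ solves (2), and if and only if $(q,s)$ solves the nonpotential sG equation (when $\sigma=1$), respectively the nonlocal sG equation (when $\sigma=-1$). * For an arbitrary function $s$: when $\sigma=1$, $(q,r,s)$ solves (2) if and only if $(q,s)$ solves the nonpotential sG equation. When $\sigma=-1$, if $(q,r,s)$ solves (2), then $(q,s)$ solves the nonlocal sG equation; the converse holds if $s(-x,-t)=s(x,t)$. **(b) Solutions.** Let $n\ge 0$, let $A,T\in\mathbb K^{2(n+1)\times2(n+1)}$ with $A$ invertible, $AT+\sigma TA=0$ and $T^2=-\sigma I$, let $C^+\in\mathbb K^{2(n+1)}$, $C^-=TC^+$, and $$\varphi=\exp\!\left(-Ax-\tfrac14A^{-1}t\right)C^+,\qquad \psi=\exp\!\left(Ax+\tfrac14A^{-1}t\right)C^-.$$ Let $|\widehat\varphi^{(a)};\widehat\psi^{(b)}|$ be the determinant with columns $\varphi,\partial_x\varphi,\dots,\partial_x^a\varphi,\psi,\partial_x\psi,\dots,\partial_x^b\psi$ (no columns of $\varphi$ if $a=-1$, none of $\psi$ if $b=-1$). Put $f=|\widehat\varphi^{(n)};\widehat\psi^{(n)}|$,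 $g=2|\widehat\varphi^{(n+1)};\widehat\psi^{(n-1)}|$, $h=2|\widehat\varphi^{(n-1)};\widehat\psi^{(n+1)}|$, and, where $f\neq0$, $$q=\frac hf=\frac{2|\widehat\varphi^{(n-1)};\widehat\psi^{(n+1)}|}{|\widehat\varphi^{(n)};\widehat\psi^{(n)}|},\qquad r=-\frac gf,\qquad s=\tfrac12-\partial_t\!\left(\frac{f_x}{f}\right).$$ Then $\psi(x,t)=T\varphi(\sigma x,\sigma t)$. The set $U=\{f\ne0\}$ is open and invariant under $(x,t)\mapsto(\sigma x,\sigma t)$, and on $U$ one has $r(x,t)=-q(\sigma x,\sigma t)$ and $s(\sigma x,\sigma t)=s(x,t)$. On $U$, $(q,r,s)$ solves (2), and $(q,s)$ solves the nonpotential sG equation if $\sigma=1$ and the nonlocal sG equation if $\sigma=-1$. If moreover $U=\mathbb R^2$ and, for every $t$, $(qr)_t(\cdot,t)$ is integrable and $s(x,t)\to\frac12$ as $|x|\to\infty$, then $s=\partial_x^{-1}(qr)_t+\tfrac12$ and $(q,r)$ solves (1). **(c) Block matrices.** For every $K\in\mathbb K^{(n+1)\times(n+1)}$ the conditions $AT+\sigma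 TA=0$, $T^2=-\sigma I$ hold for $A=\begin{pmatrix}K&0\\0&-K\end{pmatrix}$ with $T=\begin{pmatrix}0&-I\\I&0\end{pmatrix}$ if $\sigma=1$, and with $T=\begin{pmatrix}-I&0\\0&I\end{pmatrix}$ if $\sigma=-1$. **(d) Explicit $\varphi$.** Let $\mu(k)=-kx-\frac t{4k}$ and $A=\begin{pmatrix}K&0\\0&-K\end{pmatrix}$. If $K=\mathrm{Diag}(k_1,\dots,k_{n+1})$ with all $k_i\ne0$ and $C^+=(c_1,\dots,c_{n+1},d_1,\dots,d_{n+1})^T$, then $A$ is invertible and $$\varphi=\left(c_1e^{\mu(k_1)},\dots,c_{n+1}e^{\mu(k_{n+1})},d_1e^{\mu(-k_1)},\dots,d_{n+1}e^{\mu(-k_{n+1})}\right)^T.$$ If $K$ is the lower triangular Jordan block of order $n+1$ with eigenvalue $k\neq0$ (entries $1$ on the subdiagonal), $c,d$ are functions of $k$ that are $n$ times continuously differentiable at $k$, and $C^+=\left(c,\dots,\frac{\partial_k^nc}{n!},d,\dots,\frac{\partial_k^nd}{n!}\right)^T$, then $A$ is invertible and $$\varphi=\left(ce^{\mu(k)},\tfrac{\partial_k}{1!}(ce^{\mu(k)}),\dots,\tfrac{\partial_k^n}{n!}(ce^{\mu(k)}),de^{\mu(-k)},\tfrac{\partial_k}{1!}(de^{\mu(-k)}),\dots,\tfrac{\partial_k^n}{n!}(de^{\mu(-k)})\right)^T.$$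 **(e) Gauge.** Let $\sigma=-1$, let $A,T$ be as in (c), and let $K$ be diagonal or a Jordan block as in (d). At every point where $f\ne0$, replacing $C^+$ by $(1,\dots,1)^T$ (and $C^-$ by $T(1,\dots,1)^T$) keeps $f\neq0$ and does not change $q$. -/

import Mathlib

open MeasureTheory Filter Topology

namespace SineGordon

noncomputable section

/-- Partial derivative in the first variable `x`. -/
def dx {𝕜 : Type*} [RCLike 𝕜] (u : ℝ → ℝ → 𝕜) (x t : ℝ) : 𝕜 := deriv (fun ξ => u ξ t) x

/-- Partial derivative in the second variable `t`. -/
def dt {𝕜 : Type*} [RCLike 𝕜] (u : ℝ → ℝ → 𝕜) (x t : ℝ) : 𝕜 := deriv (fun τ => u x τ) t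

/-- The product of two functions of `(x,t)`. -/
def prodFun {𝕜 : Type*} [RCLike 𝕜] (q r : ℝ → ℝ → 𝕜) (x t : ℝ) : 𝕜 := q x t * r x t

/-- The symmetric integration operator `∂ₓ⁻¹ = (1/2) (∫_{-∞}^x - ∫_x^{∞})`. -/
def intOp {𝕜 : Type*} [RCLike 𝕜] (F : ℝ → 𝕜) (x : ℝ) : 𝕜 :=
  (1 / 2 : 𝕜) * ((∫ y in Set.Iic x, F y) - ∫ y in Set.Ioi x, F y)

/-- The auxiliary function `s = ∂ₓ⁻¹ (q r)_t + 1/2`. -/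
def auxS {𝕜 : Type*} [RCLike 𝕜] (q r : ℝ → ℝ → 𝕜) (x t : ℝ) : 𝕜 :=
  intOp (fun y => dt (prodFun q r) y t) x + 1 / 2

/-- `q` is twice continuously differentiable on `U`. -/
def IsC2On {𝕜 : Type*} [RCLike 𝕜] (U : Set (ℝ × ℝ)) (q : ℝ → ℝ → 𝕜) : Prop :=
  ContDiffOn ℝ 2 (fun p : ℝ × ℝ => q p.1 p.2) U

/-- `(q r)_t` is integrable over every line `t = const`, so that `∂ₓ⁻¹ (q r)_t` makes sense. -/
def HasAux {𝕜 : Type*} [RCLike 𝕜] (q r : ℝ → ℝ → 𝕜) : Prop :=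
  ∀ t : ℝ, Integrable (fun y : ℝ => dt (prodFun q r) y t)

/-- `(q, r)` is a classical solution on the whole plane of the integro-differential AKNS(-1) system
`q_xt - 2 q ∂ₓ⁻¹ (q r)_t = q`, `r_xt - 2 r ∂ₓ⁻¹ (q r)_t = r`. -/
def IsAKNSIntSol {𝕜 : Type*} [RCLike 𝕜] (q r : ℝ → ℝ → 𝕜) : Prop :=
  IsC2On Set.univ q ∧ IsC2On Set.univ r ∧ HasAux q r ∧
  ∀ x t : ℝ,
    dt (dx q) x t - 2 * q x t * intOp (fun y => dt (prodFun q r) y t) x = q x t ∧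
    dt (dx r) x t - 2 * r x t * intOp (fun y => dt (prodFun q r) y t) x = r x t

/-- `(q, r, s)` is a classical solution on `U` of the AKNS(-1) system with auxiliary function
`q_xt = 2 q s`, `r_xt = 2 r s`, `s_x = (q r)_t`. -/
def IsAKNSSol {𝕜 : Type*} [RCLike 𝕜] (U : Set (ℝ × ℝ)) (q r s : ℝ → ℝ → 𝕜) : Prop :=
  IsC2On U q ∧ IsC2On U r ∧
  ∀ x t : ℝ, (x, t) ∈ U →
    DifferentiableAt ℝ (fun ξ => s ξ t) x ∧
    dt (dx q) x t = 2 * q x t * s x t ∧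
    dt (dx r) x t = 2 * r x t * s x t ∧
    dx s x t = dt (prodFun q r) x t

/-- `(q, s)` is a classical solution on `U` of the nonpotential sine-Gordon equation
`q_xt - 2 q s = 0`, `s_x + 2 q q_t = 0`. -/
def IsSGSol {𝕜 : Type*} [RCLike 𝕜] (U : Set (ℝ × ℝ)) (q s : ℝ → ℝ → 𝕜) : Prop :=
  IsC2On U q ∧
  ∀ x t : ℝ, (x, t) ∈ U →
    DifferentiableAt ℝ (fun ξ => s ξ t) x ∧
    dt (dx q) x t - 2 * q x t * s x t = 0 ∧
    dx s x t + 2 * q x t * dt q x t = 0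

/-- `(q, s)` is a classical solution on `U` (a set that is symmetric about the origin) of the
real nonlocal sine-Gordon equation
`q_xt(x,t) - 2 q(x,t) s(x,t) = 0`, `s_x(x,t) + [q(x,t) q(-x,-t)]_t = 0`. -/
def IsNonlocalSGSol {𝕜 : Type*} [RCLike 𝕜] (U : Set (ℝ × ℝ)) (q s : ℝ → ℝ → 𝕜) : Prop :=
  IsC2On U q ∧
  ∀ x t : ℝ, (x, t) ∈ U →
    DifferentiableAt ℝ (fun ξ => s ξ t) x ∧
    dt (dx q) x t - 2 * q x t * s x t = 0 ∧
    dx s x t + dt (fun ξ τ => q ξ τ * q (-ξ) (-τ)) x t = 0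

/-- The reduction `r(x,t) = -q(σx,σt)`. -/
def reduction {𝕜 : Type*} [RCLike 𝕜] (σ : ℝ) (q : ℝ → ℝ → 𝕜) (x t : ℝ) : 𝕜 :=
  -q (σ * x) (σ * t)

/-- `φ = exp(-A x - A⁻¹ t / 4) C`. -/
def phi {𝕜 : Type*} [RCLike 𝕜] {N : ℕ} (A : Matrix (Fin N) (Fin N) 𝕜) (C : Fin N → 𝕜)
    (x t : ℝ) : Fin N → 𝕜 :=
  (NormedSpace.exp (-(x • A) - (t / 4) • A⁻¹)).mulVec C

/-- `ψ = exp(A x + A⁻¹ t / 4) C`. -/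
def psi {𝕜 : Type*} [RCLike 𝕜] {N : ℕ} (A : Matrix (Fin N) (Fin N) 𝕜) (C : Fin N → 𝕜)
    (x t : ℝ) : Fin N → 𝕜 :=
  (NormedSpace.exp (x • A + (t / 4) • A⁻¹)).mulVec C

/-- The double Wronskian of order `N` whose first `p` columns are `φ, ∂ₓφ, …, ∂ₓ^{p-1}φ` and whose
last `N - p` columns are `ψ, ∂ₓψ, …, ∂ₓ^{N-p-1}ψ`. -/
def doubleWronskian {𝕜 : Type*} [RCLike 𝕜] {N : ℕ} (p : ℕ) (φ ψ : ℝ → ℝ → Fin N → 𝕜)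
    (x t : ℝ) : 𝕜 :=
  Matrix.det (Matrix.of fun i j : Fin N =>
    if (j : ℕ) < p then iteratedDeriv (j : ℕ) (fun ξ => φ ξ t i) x
    else iteratedDeriv ((j : ℕ) - p) (fun ξ => ψ ξ t i) x)

/-- `f = |φ̂^{(n)}; ψ̂^{(n)}|`, of order `2(n+1)`. -/
def fW {𝕜 : Type*} [RCLike 𝕜] {n : ℕ} (φ ψ : ℝ → ℝ → Fin ((n + 1) + (n + 1)) → 𝕜)
    (x t : ℝ) : 𝕜 :=
  doubleWronskian (n + 1) φ ψ x t

/-- `g = 2 |φ̂^{(n+1)}; ψ̂^{(n-1)}|`. -/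
def gW {𝕜 : Type*} [RCLike 𝕜] {n : ℕ} (φ ψ : ℝ → ℝ → Fin ((n + 1) + (n + 1)) → 𝕜)
    (x t : ℝ) : 𝕜 :=
  2 * doubleWronskian (n + 2) φ ψ x t

/-- `h = 2 |φ̂^{(n-1)}; ψ̂^{(n+1)}|`. -/
def hW {𝕜 : Type*} [RCLike 𝕜] {n : ℕ} (φ ψ : ℝ → ℝ → Fin ((n + 1) + (n + 1)) → 𝕜)
    (x t : ℝ) : 𝕜 :=
  2 * doubleWronskian n φ ψ x t

/-- `q = h / f = 2 |φ̂^{(n-1)}; ψ̂^{(n+1)}| / |φ̂^{(n)}; ψ̂^{(n)}|`. -/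
def qW {𝕜 : Type*} [RCLike 𝕜] {n : ℕ} (φ ψ : ℝ → ℝ → Fin ((n + 1) + (n + 1)) → 𝕜)
    (x t : ℝ) : 𝕜 :=
  hW φ ψ x t / fW φ ψ x t

/-- `r = -g / f`. -/
def rW {𝕜 : Type*} [RCLike 𝕜] {n : ℕ} (φ ψ : ℝ → ℝ → Fin ((n + 1) + (n + 1)) → 𝕜)
    (x t : ℝ) : 𝕜 :=
  -(gW φ ψ x t) / fW φ ψ x t

/-- `s = 1/2 - ∂_t (f_x / f) = 1/2 - ∂_t ∂_x log f`. -/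
def sW {𝕜 : Type*} [RCLike 𝕜] {n : ℕ} (φ ψ : ℝ → ℝ → Fin ((n + 1) + (n + 1)) → 𝕜)
    (x t : ℝ) : 𝕜 :=
  1 / 2 - dt (fun ξ τ => dx (fW φ ψ) ξ τ / fW φ ψ ξ τ) x t

/-- The set where `f` does not vanish, that is, where `q = h / f` is defined. -/
def regularSet {𝕜 : Type*} [RCLike 𝕜] {n : ℕ} (φ ψ : ℝ → ℝ → Fin ((n + 1) + (n + 1)) → 𝕜) :
    Set (ℝ × ℝ) :=
  {p | fW φ ψ p.1 p.2 ≠ 0}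

/-- The condition `A T + σ T A = 0`, `T² = -σ I`. -/
def Admissible {𝕜 : Type*} [RCLike 𝕜] {N : ℕ} (σ : ℝ) (A T : Matrix (Fin N) (Fin N) 𝕜) : Prop :=
  A * T + σ • (T * A) = 0 ∧ T ^ 2 = -(σ • (1 : Matrix (Fin N) (Fin N) 𝕜))

/-- The block matrix `(M₁ M₂; M₃ M₄)` with blocks of order `n + 1`. -/
def blocks {𝕜 : Type*} {n : ℕ} (M₁ M₂ M₃ M₄ : Matrix (Fin (n + 1)) (Fin (n + 1)) 𝕜) :
    Matrix (Fin ((n + 1) + (n + 1))) (Fin ((n + 1) + (n + 1))) 𝕜 :=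
  Matrix.reindex finSumFinEquiv finSumFinEquiv (Matrix.fromBlocks M₁ M₂ M₃ M₄)

/-- The matrix `A` with blocks `K, 0, 0, -K`. -/
def blockA {𝕜 : Type*} [RCLike 𝕜] {n : ℕ} (K : Matrix (Fin (n + 1)) (Fin (n + 1)) 𝕜) :
    Matrix (Fin ((n + 1) + (n + 1))) (Fin ((n + 1) + (n + 1))) 𝕜 :=
  blocks K 0 0 (-K)

/-- The matrix `T` for `σ = 1`: blocks `0, -I, I, 0`. -/
def blockTPlus (𝕜 : Type*) [RCLike 𝕜] (n : ℕ) :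
    Matrix (Fin ((n + 1) + (n + 1))) (Fin ((n + 1) + (n + 1))) 𝕜 :=
  blocks 0 (-1) 1 0

/-- The matrix `T` for `σ = -1`: blocks `-I, 0, 0, I`. -/
def blockTMinus (𝕜 : Type*) [RCLike 𝕜] (n : ℕ) :
    Matrix (Fin ((n + 1) + (n + 1))) (Fin ((n + 1) + (n + 1))) 𝕜 :=
  blocks (-1) 0 0 1

/-- The lower triangular Jordan matrix of order `n + 1` with eigenvalue `k`. -/
def jordan {𝕜 : Type*} [RCLike 𝕜] (n : ℕ) (k : 𝕜) : Matrix (Fin (n + 1)) (Fin (n + 1)) 𝕜 :=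
  Matrix.of fun i j => if i = j then k else if (i : ℕ) = (j : ℕ) + 1 then 1 else 0

/-- `exp(μ(k))` with `μ(k) = -k x - t / (4 k)`. -/
def expMu {𝕜 : Type*} [RCLike 𝕜] (x t : ℝ) (k : 𝕜) : 𝕜 :=
  NormedSpace.exp (-k * (x : 𝕜) - (t : 𝕜) / (4 * k))

/-- `(c₁ e^{μ(k₁)}, …, c_{n+1} e^{μ(k_{n+1})}, d₁ e^{μ(-k₁)}, …, d_{n+1} e^{μ(-k_{n+1})})`. -/
def phiDiag {𝕜 : Type*} [RCLike 𝕜] {n : ℕ} (k c d : Fin (n + 1) → 𝕜) (x t : ℝ) :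
    Fin ((n + 1) + (n + 1)) → 𝕜 :=
  Fin.append (fun i => c i * expMu x t (k i)) (fun i => d i * expMu x t (-k i))

/-- The vector with entries `∂_k^j (c e^{μ(k)}) / j!`, `0 ≤ j ≤ n`, followed by
`∂_k^j (d e^{μ(-k)}) / j!`, `0 ≤ j ≤ n`. -/
def phiJordan {𝕜 : Type*} [RCLike 𝕜] (n : ℕ) (k : 𝕜) (c d : 𝕜 → 𝕜) (x t : ℝ) :
    Fin ((n + 1) + (n + 1)) → 𝕜 :=
  Fin.append
    (fun j : Fin (n + 1) =>
      iteratedDeriv (j : ℕ) (fun κ => c κ * expMu x t κ) k / (Nat.factorial (j : ℕ) : 𝕜))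
    (fun j : Fin (n + 1) =>
      iteratedDeriv (j : ℕ) (fun κ => d κ * expMu x t (-κ)) k / (Nat.factorial (j : ℕ) : 𝕜))

/-- The Taylor coefficients of `c` and of `d` at `k` up to order `n`. -/
def taylorVec {𝕜 : Type*} [RCLike 𝕜] (n : ℕ) (k : 𝕜) (c d : 𝕜 → 𝕜) :
    Fin ((n + 1) + (n + 1)) → 𝕜 :=
  Fin.append
    (fun j : Fin (n + 1) => iteratedDeriv (j : ℕ) c k / (Nat.factorial (j : ℕ) : 𝕜))
    (fun j : Fin (n + 1) => iteratedDeriv (j : ℕ) d k / (Nat.factorial (j : ℕ) : 𝕜))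

end

end SineGordon

open SineGordon

open scoped Matrix

/-! Let `W` be the matrix of the double Wronskian `f`, with columns `(-A)^j φ` and `A^j ψ`, and let
`J` be the diagonal matrix with `n + 1` entries `1` and then `n + 1` entries `-1`. The exponentials
give `W_x = -A W J` and `W_t = -(1/4) A⁻¹ W J`. Where `f ≠ 0`, put `B = W⁻¹ A W` and `L = B⁻¹ J B`.
Then `B_x = B [J, B]`, `B_t = (L - J) / 4`, `L_x = [L, [J, B]]` and `B_xt = [L, [J, B]] / 4`. This
closed matrix system contains (2). `A` sends each column of `W` to plus or minus the next column of
its block, except the last columns, with indices `l = idxL n` and `r = idxR n`. Hence `[J, B]` lives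
in columns `l, r`, every other column of `L` is diagonal, and the entries of `[L, [J, B]]` at `l, r`
involve only entries of `L` and `B` at `l, r`. Cramer's rule gives `q = -2 (-1)^n B_lr` and, for the
function `r = -g/f`, the value `2 (-1)^n B_rl`; Jacobi's formula gives `s = (L_ll - L_rr) / 4`.
System (2) is then an identity between these entries. For the reduction, `A T = -σ T A` lets `T`
intertwine the two exponentials, so `ψ(x,t) = T φ(σx,σt)`. Reflection therefore sends `W` to `T W S`
with a weighted block swap `S`, and comparing entries of the conjugates of `A` yields `r(x,t) =
-q(σx,σt)`. For the integral form, `∂ₓ⁻¹` of a continuous integrable function is an antiderivative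
of it, so the third equation of (2) is automatic and the constant `1/2` absorbs the right-hand side
of (1). Conversely, equal limits `1/2` at both ends fix the constant of integration. For a Jordan
block, lower triangular Toeplitz matrices represent multiplication of Taylor expansions at `k`;
`exp_tay` says that this representation respects exponentials. The gauge statement holds because the
commutant of `K` carries `(1, …, 1)` to every vector, and a matrix commuting with `A` and `T`
multiplies all double Wronskians by the same determinant. -/

namespace SineGordon

/-! ### Determinants, and the conjugate of a diagonal sign matrix -/

section LinearAlgebra

variable {R : Type*} [CommRing R]

/-- If row `p` is zero outside column `c` and the complementary minor is the identity, the
determinant is a signed entry. -/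
theorem det_eq_of_row_of_submatrix {k : ℕ} (Q : Matrix (Fin (k + 1)) (Fin (k + 1)) R)
    (p c : Fin (k + 1)) (hrow : ∀ j, j ≠ c → Q p j = 0)
    (hsub : Q.submatrix p.succAbove c.succAbove = 1) :
    Q.det = (-1) ^ ((p : ℕ) + (c : ℕ)) * Q p c := by
  rw [Matrix.det_succ_row Q p, Finset.sum_eq_single c]
  · rw [hsub, Matrix.det_one, mul_one]
  · intro j _ hj
    rw [hrow j hj]; ring
  · simp

theorem det_updateCol_eq_adjugate {ι : Type*} [Fintype ι] [DecidableEq ι] (M M' : Matrix ι ι R) :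
    ∑ i, (M.updateCol i (fun k => M' k i)).det = (M.adjugate * M').trace := by
  simp only [Matrix.trace, Matrix.diag, Matrix.mul_apply]
  refine Finset.sum_congr rfl fun i _ => ?_
  rw [← Matrix.cramer_apply, Matrix.cramer_eq_adjugate_mulVec]
  rfl

variable {ι : Type*} [Fintype ι] [DecidableEq ι]

section Conj

variable {B J L : Matrix ι ι R} {d : ι → R} {n m : ι}

/-- The hypothesis `hz` says that `J` acts on column `j` of `B` as the scalar `d j`; thus the `j`-th
basis vector is an eigenvector of `B⁻¹ J B`. -/
theorem conj_apply_eq (hJ : J = Matrix.diagonal d) (hB : IsUnit B.det) (hL : L = B⁻¹ * J * B)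
    (hz : ∀ i j, j ≠ n → j ≠ m → d i * B i j = d j * B i j) (i j : ι) (hn : j ≠ n) (hm : j ≠ m) :
    L i j = if i = j then d j else 0 := by
  have h1 : ∀ k, (J * B) k j = (d j) * B k j := fun k => by
    rw [hJ, Matrix.diagonal_mul, hz k j hn hm]
  rw [hL, mul_assoc, Matrix.mul_apply]
  simp_rw [h1]
  have h2 : (B⁻¹ * B) i j = (1 : Matrix ι ι R) i j := by rw [Matrix.nonsing_inv_mul _ hB]
  rw [Matrix.mul_apply, Matrix.one_apply] at h2
  calc ∑ k, B⁻¹ i k * (d j * B k j) = d j * ∑ k, B⁻¹ i k * B k j := by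
        rw [Finset.mul_sum]; exact Finset.sum_congr rfl fun k _ => by ring
    _ = _ := by rw [h2]; simp

theorem commutator_apply (hJ : J = Matrix.diagonal d) (i j : ι) :
    (J * B - B * J) i j = (d i - d j) * B i j := by
  rw [Matrix.sub_apply, hJ, Matrix.diagonal_mul, Matrix.mul_diagonal]; ring

theorem sum_eq_two_terms (hnm : n ≠ m) {F : ι → R} (h : ∀ i, i ≠ n → i ≠ m → F i = 0) :
    ∑ i, F i = F n + F m := by
  rw [← Finset.sum_pair hnm]
  refine (Finset.sum_subset (Finset.subset_univ _) fun i _ hi => ?_).symm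
  simp only [Finset.mem_insert, Finset.mem_singleton, not_or] at hi
  exact h i hi.1 hi.2

/-- Closure on two indices: in the first product row `p` of `L` vanishes off the columns `n, m`, and
in the second the commutator does. -/
theorem bracket_apply (hnm : n ≠ m) (hJ : J = Matrix.diagonal d) (hB : IsUnit B.det)
    (hL : L = B⁻¹ * J * B) (hz : ∀ i j, j ≠ n → j ≠ m → d i * B i j = d j * B i j)
    (p q : ι) (hp : p = n ∨ p = m) :
    (L * (J * B - B * J) - (J * B - B * J) * L) p q =
      (L p n * ((d n - d q) * B n q) + L p m * ((d m - d q) * B m q)) -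
      ((d p - d n) * B p n * L n q + (d p - d m) * B p m * L m q) := by
  rw [Matrix.sub_apply, Matrix.mul_apply, Matrix.mul_apply]
  simp_rw [commutator_apply hJ]
  rw [sum_eq_two_terms hnm, sum_eq_two_terms hnm]
  · intro i hin him
    rw [sub_mul, hz p i hin him]; ring
  · intro i hin him
    rw [conj_apply_eq hJ hB hL hz p i hin him, if_neg]
    · ring
    · rintro rfl; tauto

/-- Every index other than `n, m` contributes `d i * d i = 1`. The resulting `-2` later cancels the
constant `1/2` in `s`. -/
theorem trace_conj_mul (hnm : n ≠ m) (hJ : J = Matrix.diagonal d) (hB : IsUnit B.det)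
    (hL : L = B⁻¹ * J * B) (hz : ∀ i j, j ≠ n → j ≠ m → d i * B i j = d j * B i j)
    (hd : ∀ i, d i * d i = 1) (hn : d n = 1) (hm : d m = -1) :
    (L * J).trace = (Fintype.card ι : R) - 2 + (L n n - L m m) := by
  have h1 : (L * J).trace = ∑ i, (L i i * d i - 1) + (Fintype.card ι : R) := by
    simp [Matrix.trace, hJ, Matrix.mul_diagonal]
  rw [h1, sum_eq_two_terms hnm, hn, hm]
  · ring
  · intro i hin him
    rw [conj_apply_eq hJ hB hL hz i i hin him, if_pos rfl, hd, sub_self]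

end Conj

end LinearAlgebra

/-! ### Jacobi's formula for the derivative of a determinant -/

section Jacobi

variable {𝕜 : Type*} [RCLike 𝕜] {ι : Type*} [Fintype ι] [DecidableEq ι]

theorem hasDerivAt_det {M : ℝ → Matrix ι ι 𝕜} {M' : Matrix ι ι 𝕜} {x : ℝ}
    (h : ∀ i j, HasDerivAt (fun ξ => M ξ i j) (M' i j) x) :
    HasDerivAt (fun ξ => (M ξ).det) ((M x).adjugate * M').trace x := by
  rw [← det_updateCol_eq_adjugate]
  simp only [Matrix.det_apply']
  rw [Finset.sum_comm]
  refine HasDerivAt.fun_sum fun σ _ => ?_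
  rw [← Finset.mul_sum]
  refine HasDerivAt.const_mul _ ?_
  refine (HasDerivAt.fun_finsetProd (u := Finset.univ)
    (fun i _ => h (σ i) i)).congr_deriv ?_
  refine Finset.sum_congr rfl fun i _ => ?_
  rw [← Finset.mul_prod_erase Finset.univ _ (Finset.mem_univ i), smul_eq_mul, mul_comm]
  congr 1
  · simp
  · refine Finset.prod_congr rfl fun j hj => ?_
    rw [Matrix.updateCol_ne (Finset.ne_of_mem_erase hj)]

/-- Since `adj(M) M = det(M) I`, a derivative of the form `M X` needs no invertibility of `M`. -/
theorem hasDerivAt_det_mul {M : ℝ → Matrix ι ι 𝕜} {X : Matrix ι ι 𝕜} {x : ℝ}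
    (h : ∀ i j, HasDerivAt (fun ξ => M ξ i j) ((M x * X) i j) x) :
    HasDerivAt (fun ξ => (M ξ).det) ((M x).det * X.trace) x := by
  refine (hasDerivAt_det h).congr_deriv ?_
  rw [← mul_assoc, Matrix.adjugate_mul, Matrix.smul_mul, one_mul, Matrix.trace_smul, smul_eq_mul]

end Jacobi

end SineGordon

namespace SineGordon

/-! ### Derivatives of inverses, conjugates and exponentials of matrices -/

section MatrixCalculus

open scoped Matrix.Norms.Operator

variable {𝕜 : Type*} [RCLike 𝕜] {ι : Type*} [Fintype ι] [DecidableEq ι]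

/-- The entry of a matrix as a continuous real-linear map. -/
def entryL (𝕜 : Type*) [RCLike 𝕜] {ι : Type*} [Fintype ι] [DecidableEq ι] (i j : ι) :
    Matrix ι ι 𝕜 →L[ℝ] 𝕜 where
  toFun M := M i j
  map_add' _ _ := rfl
  map_smul' _ _ := rfl
  cont := by
    fun_prop

theorem hasDerivAt_entry {M : ℝ → Matrix ι ι 𝕜} {M' : Matrix ι ι 𝕜} {x : ℝ}
    (h : HasDerivAt M M' x) (i j : ι) : HasDerivAt (fun ξ => M ξ i j) (M' i j) x :=
  (entryL 𝕜 i j).hasFDerivAt.comp_hasDerivAt x h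

theorem hasDerivAt_trace {M : ℝ → Matrix ι ι 𝕜} {M' : Matrix ι ι 𝕜} {x : ℝ}
    (h : HasDerivAt M M' x) : HasDerivAt (fun ξ => (M ξ).trace) M'.trace x :=
  HasDerivAt.fun_sum fun i _ => hasDerivAt_entry h i i

theorem hasDerivAt_matrix_inv {M : ℝ → Matrix ι ι 𝕜} {M' : Matrix ι ι 𝕜} {x : ℝ}
    (h : HasDerivAt M M' x) (hx : IsUnit (M x).det) :
    HasDerivAt (fun ξ => (M ξ)⁻¹) (-((M x)⁻¹ * M' * (M x)⁻¹)) x := by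
  have hu : IsUnit (M x) := (Matrix.isUnit_iff_isUnit_det _).2 hx
  obtain ⟨u, hu⟩ := hu
  have h1 := hasFDerivAt_ringInverse (𝕜 := ℝ) u
  rw [hu] at h1
  have h2 := h1.comp_hasDerivAt x h
  have h3 : ((u⁻¹ : (Matrix ι ι 𝕜)ˣ) : Matrix ι ι 𝕜) = (M x)⁻¹ := by
    rw [← hu, Matrix.coe_units_inv]
  simp only [Matrix.nonsing_inv_eq_ringInverse] at h3 ⊢
  refine h2.congr_deriv ?_
  simp [h3]

/-- The derivative is the commutator of the conjugate with `M⁻¹ M'`, which is the shape of a Lax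
equation. -/
theorem hasDerivAt_conj {M : ℝ → Matrix ι ι 𝕜} {M' A : Matrix ι ι 𝕜} {x : ℝ}
    (h : HasDerivAt M M' x) (hx : IsUnit (M x).det) :
    HasDerivAt (fun ξ => (M ξ)⁻¹ * A * M ξ)
      ((M x)⁻¹ * A * M' - (M x)⁻¹ * M' * ((M x)⁻¹ * A * M x)) x := by
  refine (((hasDerivAt_matrix_inv h hx).mul_const A).mul h).congr_deriv ?_
  noncomm_ring

/-- `exp(-A x - A⁻¹ t / 4)`. -/
noncomputable def expMat (A : Matrix ι ι 𝕜) (x t : ℝ) : Matrix ι ι 𝕜 :=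
  NormedSpace.exp (-(x • A) - (t / 4) • A⁻¹)

/-- `A` and `A⁻¹` commute, so the exponential splits into two one-parameter groups, each easy to
differentiate. -/
theorem expMat_eq_mul (A : Matrix ι ι 𝕜) (hA : IsUnit A.det) (x t : ℝ) :
    expMat A x t = NormedSpace.exp (x • (-A)) * NormedSpace.exp (t • (-((1 / 4 : ℝ) • A⁻¹))) := by
  rw [← Matrix.exp_add_of_commute]
  · unfold expMat
    congr 1
    rw [smul_neg, smul_neg, smul_smul]
    rw [sub_eq_add_neg]
    congr 3
    ring
  · have : Commute A A⁻¹ := by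
      rw [Commute, SemiconjBy, Matrix.mul_nonsing_inv _ hA, Matrix.nonsing_inv_mul _ hA]
    exact ((this.neg_left.smul_left x).smul_right (1 / 4 : ℝ)).neg_right.smul_right t

theorem commute_expMat {A S : Matrix ι ι 𝕜} (hA : IsUnit A.det) (h : Commute S A) (x t : ℝ) :
    Commute S (expMat A x t) := by
  have h' : Commute S A⁻¹ := by
    have h1 : A⁻¹ * (A * S) * A⁻¹ = A⁻¹ * (S * A) * A⁻¹ := by rw [h.eq]
    rw [Matrix.nonsing_inv_mul_cancel_left _ _ hA, mul_assoc, mul_assoc,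
      Matrix.mul_nonsing_inv _ hA, mul_one] at h1
    exact h1
  exact ((h.smul_right x).neg_right.sub_right (h'.smul_right (t / 4))).exp_right

theorem hasDerivAt_expMat_x (A : Matrix ι ι 𝕜) (hA : IsUnit A.det) (x t : ℝ) :
    HasDerivAt (fun ξ => expMat A ξ t) (-A * expMat A x t) x := by
  simp_rw [expMat_eq_mul A hA]
  exact ((hasDerivAt_exp_smul_const' (-A) x).mul_const _).congr_deriv (by rw [mul_assoc]; rfl)

theorem hasDerivAt_expMat_t (A : Matrix ι ι 𝕜) (hA : IsUnit A.det) (x t : ℝ) :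
    HasDerivAt (fun τ => expMat A x τ) (-((1 / 4 : ℝ) • A⁻¹) * expMat A x t) t := by
  have hc : Commute (-((1 / 4 : ℝ) • A⁻¹)) (expMat A x t) := by
    refine commute_expMat hA ?_ x t
    refine (Commute.smul_left ?_ _).neg_left
    rw [Commute, SemiconjBy, Matrix.mul_nonsing_inv _ hA, Matrix.nonsing_inv_mul _ hA]
  rw [hc.eq]
  simp_rw [expMat_eq_mul A hA]
  exact ((hasDerivAt_exp_smul_const (-((1 / 4 : ℝ) • A⁻¹)) t).const_mul _).congr_deriv
    (by rw [mul_assoc]; rfl)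

theorem contDiff_expMat_apply {k : WithTop ℕ∞} (A : Matrix ι ι 𝕜) (i j : ι) :
    ContDiff ℝ k (fun p : ℝ × ℝ => expMat A p.1 p.2 i j) := by
  refine (entryL 𝕜 i j).contDiff.comp ?_
  have h1 : ContDiff ℝ k (NormedSpace.exp : Matrix ι ι 𝕜 → Matrix ι ι 𝕜) := by
    rw [contDiff_iff_contDiffAt]
    intro M
    exact (NormedSpace.exp_analytic (𝕂 := ℝ) M).contDiffAt
  refine h1.comp ?_
  fun_prop

end MatrixCalculus

end SineGordon

namespace SineGordon

/-! ### The Wronskian matrix and Cramer's rule -/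

section ColumnMatrix

variable {R : Type*} [CommRing R]

/-- The matrix with first `p` columns `(-A)^j φ` and remaining columns `A^j ψ`. -/
def colMat {N : ℕ} (p : ℕ) (A : Matrix (Fin N) (Fin N) R) (φ ψ : Fin N → R) :
    Matrix (Fin N) (Fin N) R :=
  Matrix.of fun i j =>
    if (j : ℕ) < p then ((-A) ^ (j : ℕ) *ᵥ φ) i else (A ^ ((j : ℕ) - p) *ᵥ ψ) i

/-- The diagonal matrix with `p` entries `1` followed by entries `-1`. -/
def signMat (R : Type*) [CommRing R] (N p : ℕ) : Matrix (Fin N) (Fin N) R :=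
  Matrix.diagonal fun j => if (j : ℕ) < p then 1 else -1

/-- The matrix of `A` in the basis of the columns of `colMat`. -/
noncomputable def conjMat {N : ℕ} (p : ℕ) (A : Matrix (Fin N) (Fin N) R) (φ ψ : Fin N → R) :
    Matrix (Fin N) (Fin N) R :=
  (colMat p A φ ψ)⁻¹ * A * colMat p A φ ψ

/-- The last index of the first block. -/
def idxL (n : ℕ) : Fin ((n + 1) + (n + 1)) := ⟨n, by omega⟩

/-- The last index of the second block. -/
def idxR (n : ℕ) : Fin ((n + 1) + (n + 1)) := ⟨n + 1 + n, by omega⟩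

theorem idxL_ne_idxR (n : ℕ) : idxL n ≠ idxR n := by
  simp [idxL, idxR]

theorem neg_mulVec_pow {N : ℕ} (A : Matrix (Fin N) (Fin N) R) (φ : Fin N → R) (k : ℕ) :
    A *ᵥ ((-A) ^ k *ᵥ φ) = -((-A) ^ (k + 1) *ᵥ φ) := by
  rw [pow_succ', ← Matrix.mulVec_mulVec, Matrix.neg_mulVec, neg_neg]

theorem mulVec_pow {N : ℕ} (A : Matrix (Fin N) (Fin N) R) (φ : Fin N → R) (k : ℕ) :
    A *ᵥ (A ^ k *ᵥ φ) = A ^ (k + 1) *ᵥ φ := by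
  rw [pow_succ', ← Matrix.mulVec_mulVec]

theorem mul_colMat_apply {N : ℕ} (p : ℕ) (A : Matrix (Fin N) (Fin N) R) (φ ψ : Fin N → R)
    (i j : Fin N) : (A * colMat p A φ ψ) i j =
      if (j : ℕ) < p then -((-A) ^ ((j : ℕ) + 1) *ᵥ φ) i
      else (A ^ ((j : ℕ) - p + 1) *ᵥ ψ) i := by
  have : (A * colMat p A φ ψ) i j = (A *ᵥ fun k => colMat p A φ ψ k j) i := rfl
  rw [this]
  simp only [colMat, Matrix.of_apply]
  split_ifs
  · exact congrFun (neg_mulVec_pow A φ j) i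
  · exact congrFun (mulVec_pow A ψ _) i

variable {n : ℕ} {A : Matrix (Fin ((n + 1) + (n + 1))) (Fin ((n + 1) + (n + 1))) R}
  {φ ψ : Fin ((n + 1) + (n + 1)) → R}

theorem inv_mul_apply_of_col {N : ℕ} {W H : Matrix (Fin N) (Fin N) R} (hW : IsUnit W.det)
    {j j' : Fin N} {c : R} (h : ∀ i, H i j = c * W i j') (i : Fin N) :
    (W⁻¹ * H) i j = if i = j' then c else 0 := by
  have h2 : (W⁻¹ * W) i j' = (1 : Matrix (Fin N) (Fin N) R) i j' := by
    rw [Matrix.nonsing_inv_mul _ hW]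
  rw [Matrix.mul_apply, Matrix.one_apply] at h2
  rw [Matrix.mul_apply]
  simp_rw [h]
  calc ∑ k, W⁻¹ i k * (c * W k j') = c * ∑ k, W⁻¹ i k * W k j' := by
        rw [Finset.mul_sum]; exact Finset.sum_congr rfl fun k _ => by ring
    _ = _ := by rw [h2]; simp

/-- Unless `j` is the last index of a block, `A` sends column `j` to `∓` column `j + 1` of the same
block. The only nonzero entry of this column of the conjugate then has the sign of `j`. -/
theorem conjMat_apply_zero (hW : IsUnit (colMat (n + 1) A φ ψ).det)
    (i j : Fin ((n + 1) + (n + 1))) (hn : j ≠ idxL n) (hm : j ≠ idxR n) :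
    (if (i : ℕ) < n + 1 then (1 : R) else -1) * conjMat (n + 1) A φ ψ i j =
      (if (j : ℕ) < n + 1 then (1 : R) else -1) * conjMat (n + 1) A φ ψ i j := by
  have hn' : (j : ℕ) ≠ n := fun h => hn (Fin.ext h)
  have hm' : (j : ℕ) ≠ n + 1 + n := fun h => hm (Fin.ext h)
  have hj := j.2
  rw [conjMat, mul_assoc]
  by_cases hjn : (j : ℕ) < n + 1
  · rw [inv_mul_apply_of_col hW (j' := ⟨(j : ℕ) + 1, by omega⟩) (c := -1)]
    · by_cases hi : i = ⟨(j : ℕ) + 1, by omega⟩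
      · have hi' : (i : ℕ) < n + 1 := by rw [hi]; simp only; omega
        simp only [hi', hjn, if_true]
      · simp only [hi, if_false, mul_zero]
    · intro k
      rw [mul_colMat_apply, if_pos hjn, colMat, Matrix.of_apply,
        if_pos (show (j : ℕ) + 1 < n + 1 by omega)]
      ring
  · rw [inv_mul_apply_of_col hW (j' := ⟨(j : ℕ) + 1, by omega⟩) (c := 1)]
    · by_cases hi : i = ⟨(j : ℕ) + 1, by omega⟩
      · have hi' : ¬ (i : ℕ) < n + 1 := by rw [hi]; simp only; omega
        simp only [hi', hjn, if_false]
      · simp only [hi, if_false, mul_zero]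
    · intro k
      rw [mul_colMat_apply, if_neg hjn, colMat, Matrix.of_apply,
        if_neg (show ¬ (j : ℕ) + 1 < n + 1 by omega), one_mul]
      congr 3
      simp only
      omega

/-- Cramer's rule for the double Wronskian with one column less in the first block. -/
theorem det_colMat_pred (hW : IsUnit (colMat (n + 1) A φ ψ).det) :
    (colMat n A φ ψ).det = (-1) ^ (n + 1) * (colMat (n + 1) A φ ψ).det *
      conjMat (n + 1) A φ ψ (idxL n) (idxR n) := by
  set W := colMat (n + 1) A φ ψ with hWdef
  set H := colMat n A φ ψ with hHdef
  have hH : H = W * (W⁻¹ * H) := (Matrix.mul_nonsing_inv_cancel_left _ _ hW).symm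
  -- Apart from its last column, `H` consists of the columns of `W` with the last `φ` column
  -- dropped. Its last column is `A` applied to the last column of `W`.
  have hcol : ∀ j : Fin (n + 1 + n), ∀ i,
      H i ((Fin.last (n + 1 + n)).succAbove j) = 1 * W i ((idxL n).succAbove j) := by
    intro j i
    have hv1 : (((Fin.last (n + 1 + n)).succAbove j : Fin _) : ℕ) = j := by simp
    have hv2 : (((idxL n).succAbove j : Fin (n + 1 + (n + 1))) : ℕ) =
        if (j : ℕ) < n then (j : ℕ) else j + 1 := by
      simp only [Fin.succAbove, idxL, Fin.lt_def, Fin.val_castSucc]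
      split_ifs <;> simp
    rcases lt_or_ge (j : ℕ) n with hj | hj
    · rw [if_pos hj] at hv2
      simp only [hWdef, hHdef, colMat, Matrix.of_apply, hv1, hv2, one_mul]
      rw [if_pos hj, if_pos (by omega)]
    · rw [if_neg (by omega)] at hv2
      simp only [hWdef, hHdef, colMat, Matrix.of_apply, hv1, hv2, one_mul]
      rw [if_neg (by omega), if_neg (by omega), Nat.add_sub_add_right]
  have hdet : (W⁻¹ * H).det = (-1) ^ (n + 1) * conjMat (n + 1) A φ ψ (idxL n) (idxR n) := by
    have := det_eq_of_row_of_submatrix (k := n + 1 + n) (W⁻¹ * H) (idxL n)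
      (Fin.last (n + 1 + n)) ?_ ?_
    · rw [this]
      congr 1
      · have : ((idxL n : Fin _) : ℕ) + ((Fin.last (n + 1 + n) : Fin _) : ℕ)
          = (n + 1) + 2 * n := by simp [idxL]; ring
        rw [this, pow_add, pow_mul]; simp
      · rw [conjMat, mul_assoc, Matrix.mul_apply, Matrix.mul_apply]
        refine Finset.sum_congr rfl fun i _ => ?_
        rw [mul_colMat_apply, if_neg (by simp [idxR])]
        congr 1
        simp only [hHdef, colMat, Matrix.of_apply, Fin.val_last, idxR]
        rw [if_neg (by omega)]
        congr 3
        omega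
    · intro j hj
      obtain ⟨j, rfl⟩ := Fin.exists_succAbove_eq hj
      rw [inv_mul_apply_of_col hW (hcol j), if_neg (Fin.succAbove_ne _ _).symm]
    · ext i j
      rw [Matrix.submatrix_apply, inv_mul_apply_of_col hW (hcol j), Matrix.one_apply]
      simp
  calc H.det = (W * (W⁻¹ * H)).det := by rw [← hH]
    _ = _ := by rw [Matrix.det_mul, hdet]; ring

/-- Cramer's rule for the double Wronskian with one column more in the first block. -/
theorem det_colMat_succ (hW : IsUnit (colMat (n + 1) A φ ψ).det) :
    (colMat (n + 2) A φ ψ).det = -((-1) ^ n * (colMat (n + 1) A φ ψ).det *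
      conjMat (n + 1) A φ ψ (idxR n) (idxL n)) := by
  set W := colMat (n + 1) A φ ψ with hWdef
  set H := colMat (n + 2) A φ ψ with hHdef
  have hH : H = W * (W⁻¹ * H) := (Matrix.mul_nonsing_inv_cancel_left _ _ hW).symm
  -- Index of the extra column `(-A)^(n+1) φ`, which is `-A` applied to column `idxL n` of `W`; this
  -- is the source of the minus sign.
  let c : Fin (n + 1 + n + 1) := ⟨n + 1, by omega⟩
  have hcol : ∀ j : Fin (n + 1 + n), ∀ i,
      H i (c.succAbove j) = 1 * W i ((idxR n).succAbove j) := by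
    intro j i
    have hv1 : ((c.succAbove j : Fin _) : ℕ) =
        if (j : ℕ) < n + 1 then (j : ℕ) else j + 1 := by
      simp only [Fin.succAbove, c, Fin.lt_def, Fin.val_castSucc]
      split_ifs <;> simp
    have hv2 : (((idxR n).succAbove j : Fin (n + 1 + (n + 1))) : ℕ) = j := by
      have : idxR n = Fin.last (n + 1 + n) := rfl
      rw [this]; simp
    rcases lt_or_ge (j : ℕ) (n + 1) with hj | hj
    · rw [if_pos hj] at hv1
      simp only [hWdef, hHdef, colMat, Matrix.of_apply, hv1, hv2, one_mul]
      rw [if_pos hj, if_pos (by omega)]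
    · rw [if_neg (by omega)] at hv1
      simp only [hWdef, hHdef, colMat, Matrix.of_apply, hv1, hv2, one_mul]
      rw [if_neg (by omega), if_neg (by omega), Nat.add_sub_add_right]
  have hdet : (W⁻¹ * H).det = -((-1) ^ n * conjMat (n + 1) A φ ψ (idxR n) (idxL n)) := by
    have := det_eq_of_row_of_submatrix (k := n + 1 + n) (W⁻¹ * H) (idxR n) c ?_ ?_
    · rw [this, ← mul_neg]
      congr 1
      · have : ((idxR n : Fin _) : ℕ) + ((c : Fin _) : ℕ)
          = n + 2 * (n + 1) := by simp [idxR, c]; ring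
        rw [this, pow_add, pow_mul]; simp
      · rw [conjMat, mul_assoc, Matrix.mul_apply, Matrix.mul_apply, ← Finset.sum_neg_distrib]
        refine Finset.sum_congr rfl fun i _ => ?_
        rw [mul_colMat_apply, if_pos (by simp [idxL]), mul_neg, neg_neg]
        congr 1
        simp [hHdef, colMat, idxL, c]
    · intro j hj
      obtain ⟨j, rfl⟩ := Fin.exists_succAbove_eq hj
      rw [inv_mul_apply_of_col hW (hcol j), if_neg (Fin.succAbove_ne _ _).symm]
    · ext i j
      rw [Matrix.submatrix_apply, inv_mul_apply_of_col hW (hcol j), Matrix.one_apply]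
      simp
  calc H.det = (W * (W⁻¹ * H)).det := by rw [← hH]
    _ = _ := by rw [Matrix.det_mul, hdet]; ring

end ColumnMatrix

/-! ### The effect of `T` on the Wronskian matrix -/

section Reflection

variable {R : Type*} [CommRing R] {n : ℕ}
  {A T : Matrix (Fin ((n + 1) + (n + 1))) (Fin ((n + 1) + (n + 1))) R}

/-- The block swap with weights `-σ^{j+1}` and `σ^j`. -/
def swapMat (n : ℕ) (σ : R) : Matrix (Fin ((n + 1) + (n + 1))) (Fin ((n + 1) + (n + 1))) R :=
  Matrix.of fun i j =>
    if i = finAddFlip j then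
      (if (j : ℕ) < n + 1 then -σ ^ ((j : ℕ) + 1) else σ ^ ((j : ℕ) - (n + 1))) else 0

theorem mul_swapMat_apply (σ : R) (X : Matrix (Fin ((n + 1) + (n + 1))) (Fin ((n + 1) + (n + 1))) R)
    (i j : Fin ((n + 1) + (n + 1))) : (X * swapMat n σ) i j = X i (finAddFlip j) *
      (if (j : ℕ) < n + 1 then -σ ^ ((j : ℕ) + 1) else σ ^ ((j : ℕ) - (n + 1))) := by
  simp [Matrix.mul_apply, swapMat]

theorem swapMat_mul_apply (σ : R) (X : Matrix (Fin ((n + 1) + (n + 1))) (Fin ((n + 1) + (n + 1))) R)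
    (i j : Fin ((n + 1) + (n + 1))) : (swapMat n σ * X) (finAddFlip i) j =
      (if (i : ℕ) < n + 1 then -σ ^ ((i : ℕ) + 1) else σ ^ ((i : ℕ) - (n + 1))) * X i j := by
  simp only [Matrix.mul_apply, swapMat, Matrix.of_apply, EmbeddingLike.apply_eq_iff_eq, ite_mul,
    zero_mul, Finset.sum_ite_eq, Finset.mem_univ, if_true]

theorem finAddFlip_idxL (n : ℕ) : finAddFlip (idxL n) = idxR n := by
  have : idxL n = Fin.castAdd (n + 1) (Fin.last n) := rfl
  rw [this, finAddFlip_apply_castAdd]; rfl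

theorem finAddFlip_idxR (n : ℕ) : finAddFlip (idxR n) = idxL n := by
  have : idxR n = Fin.natAdd (n + 1) (Fin.last n) := rfl
  rw [this, finAddFlip_apply_natAdd]; rfl

theorem anticommute_pow {σ : R} (hAT : A * T = -(σ • (T * A))) (k : ℕ) :
    A ^ k * T = (-σ) ^ k • (T * A ^ k) := by
  induction k with
  | zero => simp
  | succ k ih =>
    rw [pow_succ', mul_assoc, ih, Matrix.mul_smul, ← mul_assoc, hAT, neg_mul, Matrix.smul_mul,
      ← neg_smul, smul_smul, ← pow_succ, mul_assoc, ← pow_succ']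

/-- Moving `T` through a power gives `T A^j ψ = T A^j T φ' = -σ^(j+1) (-A)^j φ'` and `A^j ψ' = σ^j T
(-A)^j φ`. As `σ² = 1`, each weight is its own inverse, so it may stand on either side. -/
theorem colMat_reflect {σ : R} (hσ : σ * σ = 1) (hAT : A * T = -(σ • (T * A)))
    (hT : T * T = -(σ • 1)) {φ ψ φ' ψ' : Fin ((n + 1) + (n + 1)) → R} (h1 : ψ = T *ᵥ φ')
    (h2 : ψ' = T *ᵥ φ) :
    colMat (n + 1) A φ' ψ' = T * colMat (n + 1) A φ ψ * swapMat n σ := by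
  have hp : ∀ k : ℕ, σ ^ k * σ ^ k = 1 := fun k => by rw [← mul_pow, hσ, one_pow]
  ext i j
  rw [mul_swapMat_apply]
  have hT' : (T * colMat (n + 1) A φ ψ) i (finAddFlip j) =
    (T *ᵥ fun k => colMat (n + 1) A φ ψ k (finAddFlip j)) i := rfl
  rw [hT']
  refine Fin.addCases (fun j => ?_) (fun j => ?_) j
  · rw [finAddFlip_apply_castAdd]
    simp only [colMat, Matrix.of_apply, Fin.val_castAdd, Fin.val_natAdd, Fin.is_lt, if_true,
      add_tsub_cancel_left]
    simp only [show ¬ n + 1 + (j : ℕ) < n + 1 by omega, if_false]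
    change _ = (T *ᵥ (A ^ (j : ℕ) *ᵥ ψ)) i * _
    have : ((-A) ^ (j : ℕ)) = ((-1 : R) ^ (j : ℕ)) • A ^ (j : ℕ) := by
      rw [← smul_pow, neg_one_smul]
    rw [h1, Matrix.mulVec_mulVec, Matrix.mulVec_mulVec, mul_assoc, anticommute_pow hAT,
      Matrix.mul_smul, ← mul_assoc, hT, neg_pow σ, neg_mul, Matrix.smul_mul, one_mul]
    simp only [Matrix.smul_mulVec, Matrix.neg_mulVec, Pi.smul_apply, Pi.neg_apply, smul_eq_mul]
    simp only [this, Matrix.smul_mulVec, Pi.smul_apply, smul_eq_mul]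
    linear_combination (-(-1 : R) ^ (j : ℕ) * (A ^ (j : ℕ) *ᵥ φ') i) * hp (j + 1)
  · rw [finAddFlip_apply_natAdd]
    simp only [colMat, Matrix.of_apply, Fin.val_castAdd, Fin.val_natAdd, Fin.is_lt, if_true,
      add_tsub_cancel_left]
    simp only [show ¬ n + 1 + (j : ℕ) < n + 1 by omega, if_false]
    change _ = (T *ᵥ ((-A) ^ (j : ℕ) *ᵥ φ)) i * _
    have : ((-A) ^ (j : ℕ)) = ((-1 : R) ^ (j : ℕ)) • A ^ (j : ℕ) := by
      rw [← smul_pow, neg_one_smul]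
    rw [h2, Matrix.mulVec_mulVec, Matrix.mulVec_mulVec, anticommute_pow hAT, this, neg_pow σ,
      Matrix.mul_smul]
    simp only [Matrix.smul_mulVec, Pi.smul_apply, smul_eq_mul]
    ring

/-- From `W' = T W S` and `A T = -σ T A`, the conjugates `B, B'` of `A` satisfy `S B' = -σ B S`. The
swap `S` exchanges the two distinguished indices. -/
theorem conjMat_reflect {σ : R} (hσ : σ * σ = 1) (hAT : A * T = -(σ • (T * A)))
    (hT : T * T = -(σ • 1)) {φ ψ φ' ψ' : Fin ((n + 1) + (n + 1)) → R} (h1 : ψ = T *ᵥ φ')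
    (h2 : ψ' = T *ᵥ φ) (hW : IsUnit (colMat (n + 1) A φ ψ).det)
    (hW' : IsUnit (colMat (n + 1) A φ' ψ').det) :
    conjMat (n + 1) A φ' ψ' (idxL n) (idxR n) = conjMat (n + 1) A φ ψ (idxR n) (idxL n) := by
  have hp : ∀ k : ℕ, σ ^ k * σ ^ k = 1 := fun k => by rw [← mul_pow, hσ, one_pow]
  set W := colMat (n + 1) A φ ψ with hWd
  set W' := colMat (n + 1) A φ' ψ' with hWd'
  have hr : W' = T * W * swapMat n σ := colMat_reflect hσ hAT hT h1 h2
  have hTT : (-(σ • T)) * T = 1 := by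
    rw [neg_mul, Matrix.smul_mul, hT, smul_neg, smul_smul, hσ, one_smul, neg_neg]
  have key : swapMat n σ * conjMat (n + 1) A φ' ψ' =
      -(σ • (conjMat (n + 1) A φ ψ * swapMat n σ)) := by
    have e1 : W' * conjMat (n + 1) A φ' ψ' = A * W' := by
      rw [conjMat, ← hWd', mul_assoc, Matrix.mul_nonsing_inv_cancel_left _ _ hW']
    have e2 : T * (W * (swapMat n σ * conjMat (n + 1) A φ' ψ')) =
        T * (-(σ • (A * (W * swapMat n σ)))) := by
      calc T * (W * (swapMat n σ * conjMat (n + 1) A φ' ψ'))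
          = W' * conjMat (n + 1) A φ' ψ' := by rw [hr]; simp only [mul_assoc]
        _ = (A * T) * (W * swapMat n σ) := by rw [e1, hr]; simp only [mul_assoc]
        _ = _ := by
          rw [hAT, neg_mul, Matrix.smul_mul, mul_neg, Matrix.mul_smul, mul_assoc]
    have e3 : W * (swapMat n σ * conjMat (n + 1) A φ' ψ') = -(σ • (A * (W * swapMat n σ))) := by
      have := congrArg (fun X => (-(σ • T)) * X) e2
      simpa only [← mul_assoc, hTT, one_mul] using this
    have := congrArg (fun X => W⁻¹ * X) e3
    simp only [Matrix.nonsing_inv_mul_cancel_left _ _ hW] at this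
    rw [this, conjMat, mul_neg, Matrix.mul_smul]
    simp only [mul_assoc, ← hWd]
  -- This entry reads `-σ^(n+1) B'_lr = -σ · σ^n B_rl`, and the powers of `σ` cancel.
  have e := congrFun (congrFun key (idxR n)) (idxR n)
  rw [← finAddFlip_idxL, swapMat_mul_apply, Matrix.neg_apply, Matrix.smul_apply, mul_swapMat_apply,
    finAddFlip_idxL, finAddFlip_idxR] at e
  rw [if_pos (by simp [idxL]), if_neg (by simp [idxR])] at e
  simp only [show ((idxL n : Fin _) : ℕ) = n from rfl,
    show ((idxR n : Fin _) : ℕ) = n + 1 + n from rfl, smul_eq_mul, add_tsub_cancel_left] at e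
  linear_combination (-σ ^ (n + 1)) * e + (conjMat (n + 1) A φ ψ (idxR n) (idxL n)
    - conjMat (n + 1) A φ' ψ' (idxL n) (idxR n)) * hp (n + 1)

end Reflection

end SineGordon

namespace SineGordon

/-! ### Evolution of the Wronskian matrix in `x` and `t` -/

section Evolution

open scoped Matrix.Norms.Operator

variable {𝕜 : Type*} [RCLike 𝕜] {N : ℕ}

theorem matrix_inv_neg {ι : Type*} [Fintype ι] [DecidableEq ι] {A : Matrix ι ι 𝕜}
    (hA : IsUnit A.det) : (-A)⁻¹ = -A⁻¹ :=
  Matrix.inv_eq_left_inv (by rw [neg_mul_neg, Matrix.nonsing_inv_mul _ hA])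

theorem isUnit_det_neg {ι : Type*} [Fintype ι] [DecidableEq ι] {A : Matrix ι ι 𝕜}
    (hA : IsUnit A.det) : IsUnit (-A).det := by
  rw [← Matrix.isUnit_iff_isUnit_det] at hA ⊢
  exact hA.neg

/-- The calculus of `phi` thereby covers `psi` as well. -/
theorem psi_eq_phi_neg {A : Matrix (Fin N) (Fin N) 𝕜} (hA : IsUnit A.det) (D : Fin N → 𝕜) :
    psi A D = phi (-A) D := by
  funext x t
  simp only [psi, phi]
  rw [matrix_inv_neg hA]
  congr 2
  simp

theorem hasDerivAt_phi {A : Matrix (Fin N) (Fin N) 𝕜} (hA : IsUnit A.det) (C : Fin N → 𝕜)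
    (x t : ℝ) (M : Matrix (Fin N) (Fin N) 𝕜) (i : Fin N) :
    HasDerivAt (fun ξ => (M *ᵥ phi A C ξ t) i) ((M *ᵥ (-A *ᵥ phi A C x t)) i) x := by
  have h : ∀ k, HasDerivAt (fun ξ => phi A C ξ t k) ((-A *ᵥ phi A C x t) k) x := by
    intro k
    have h1 : (-A *ᵥ phi A C x t) k = ∑ j, (-A * expMat A x t) k j * C j := by
      change (-A *ᵥ (expMat A x t *ᵥ C)) k = _
      rw [Matrix.mulVec_mulVec]; rfl
    rw [h1]
    have h2 := HasDerivAt.fun_sum (u := Finset.univ) fun j _ =>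
      (hasDerivAt_entry (hasDerivAt_expMat_x A hA x t) k j).mul_const (C j)
    exact h2
  have h3 := HasDerivAt.fun_sum (u := Finset.univ) fun k _ => (h k).const_mul (M i k)
  exact h3

theorem iteratedDeriv_phi {A : Matrix (Fin N) (Fin N) 𝕜} (hA : IsUnit A.det) (C : Fin N → 𝕜)
    (t : ℝ) (i : Fin N) (k : ℕ) :
    iteratedDeriv k (fun ξ => phi A C ξ t i) = fun x => ((-A) ^ k *ᵥ phi A C x t) i := by
  induction k with
  | zero => simp
  | succ k ih =>
    rw [iteratedDeriv_succ, ih]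
    funext x
    rw [(hasDerivAt_phi hA C x t _ i).deriv, Matrix.mulVec_mulVec, ← pow_succ]

/-- The matrix of the double Wronskian of the solutions `phi`, `psi`. -/
noncomputable def wMat (p : ℕ) (A : Matrix (Fin N) (Fin N) 𝕜) (C D : Fin N → 𝕜) (x t : ℝ) :
    Matrix (Fin N) (Fin N) 𝕜 :=
  colMat p A (phi A C x t) (psi A D x t)

theorem doubleWronskian_eq_det (p : ℕ) {A : Matrix (Fin N) (Fin N) 𝕜} (hA : IsUnit A.det)
    (C D : Fin N → 𝕜) (x t : ℝ) :
    doubleWronskian p (phi A C) (psi A D) x t = (wMat p A C D x t).det := by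
  rw [doubleWronskian, wMat, colMat]
  congr 3
  funext i j
  rw [psi_eq_phi_neg hA, iteratedDeriv_phi hA, iteratedDeriv_phi (isUnit_det_neg hA), neg_neg]

/-- Powers of `A` commute with the exponentials, so all dependence on `x, t` sits in left factors.
On the constant right factors, `J` acts as `1` and `-1`, which is how the opposite exponents combine
into one equation for `W`. -/
theorem wMat_eq (p : ℕ) {A : Matrix (Fin N) (Fin N) 𝕜} (hA : IsUnit A.det)
    (C D : Fin N → 𝕜) (x t : ℝ) :
    wMat p A C D x t =
      expMat A x t * Matrix.of (fun i j : Fin N => if (j : ℕ) < p then ((-A) ^ (j : ℕ) *ᵥ C) i else 0) +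
      expMat (-A) x t *
        Matrix.of (fun i j : Fin N => if (j : ℕ) < p then 0 else (A ^ ((j : ℕ) - p) *ᵥ D) i) := by
  have hc : ∀ k, (-A) ^ k *ᵥ (expMat A x t *ᵥ C) = expMat A x t *ᵥ ((-A) ^ k *ᵥ C) := by
    intro k
    rw [Matrix.mulVec_mulVec, Matrix.mulVec_mulVec,
      (commute_expMat hA ((Commute.refl A).neg_left.pow_left k) x t).eq]
  have hd : ∀ k, A ^ k *ᵥ (expMat (-A) x t *ᵥ D) = expMat (-A) x t *ᵥ (A ^ k *ᵥ D) := by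
    intro k
    rw [Matrix.mulVec_mulVec, Matrix.mulVec_mulVec,
      (commute_expMat (isUnit_det_neg hA) ((Commute.refl A).neg_right.pow_left k) x t).eq]
  ext i j
  rw [Matrix.add_apply, wMat, colMat, Matrix.of_apply, psi_eq_phi_neg hA]
  change (if (j : ℕ) < p then ((-A) ^ (j : ℕ) *ᵥ (expMat A x t *ᵥ C)) i
    else (A ^ ((j : ℕ) - p) *ᵥ (expMat (-A) x t *ᵥ D)) i) = _
  rw [hc, hd]
  by_cases hj : (j : ℕ) < p <;>
  simp [Matrix.mul_apply, Matrix.mulVec, dotProduct, hj]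

theorem of_left_mul_signMat (p : ℕ) (F : Fin N → Fin N → 𝕜) :
    Matrix.of (fun i j : Fin N => if (j : ℕ) < p then F i j else 0) * signMat 𝕜 N p =
      Matrix.of (fun i j : Fin N => if (j : ℕ) < p then F i j else 0) := by
  ext i j
  simp only [signMat, Matrix.mul_diagonal, Matrix.of_apply]
  split_ifs <;> simp

theorem of_right_mul_signMat (p : ℕ) (F : Fin N → Fin N → 𝕜) :
    Matrix.of (fun i j : Fin N => if (j : ℕ) < p then 0 else F i j) * signMat 𝕜 N p =
      -Matrix.of (fun i j : Fin N => if (j : ℕ) < p then 0 else F i j) := by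
  ext i j
  simp only [signMat, Matrix.mul_diagonal, Matrix.of_apply, Matrix.neg_apply]
  split_ifs <;> simp

theorem hasDerivAt_wMat_x (p : ℕ) {A : Matrix (Fin N) (Fin N) 𝕜} (hA : IsUnit A.det)
    (C D : Fin N → 𝕜) (x t : ℝ) :
    HasDerivAt (fun ξ => wMat p A C D ξ t) (-(A * wMat p A C D x t * signMat 𝕜 N p)) x := by
  simp_rw [wMat_eq p hA]
  refine (((hasDerivAt_expMat_x A hA x t).mul_const _).add
    ((hasDerivAt_expMat_x (-A) (isUnit_det_neg hA) x t).mul_const _)).congr_deriv ?_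
  rw [mul_assoc A, add_mul, mul_assoc (expMat A x t), mul_assoc (expMat (-A) x t),
    of_left_mul_signMat p (fun i j => ((-A) ^ (j : ℕ) *ᵥ C) i),
    of_right_mul_signMat p (fun i j => (A ^ ((j : ℕ) - p) *ᵥ D) i)]
  noncomm_ring

theorem hasDerivAt_wMat_t (p : ℕ) {A : Matrix (Fin N) (Fin N) 𝕜} (hA : IsUnit A.det)
    (C D : Fin N → 𝕜) (x t : ℝ) :
    HasDerivAt (fun τ => wMat p A C D x τ)
      (-((1 / 4 : ℝ) • (A⁻¹ * wMat p A C D x t * signMat 𝕜 N p))) t := by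
  simp_rw [wMat_eq p hA]
  refine (((hasDerivAt_expMat_t A hA x t).mul_const _).add
    ((hasDerivAt_expMat_t (-A) (isUnit_det_neg hA) x t).mul_const _)).congr_deriv ?_
  rw [mul_assoc A⁻¹, add_mul, mul_assoc (expMat A x t), mul_assoc (expMat (-A) x t),
    of_left_mul_signMat p (fun i j => ((-A) ^ (j : ℕ) *ᵥ C) i),
    of_right_mul_signMat p (fun i j => (A ^ ((j : ℕ) - p) *ᵥ D) i), matrix_inv_neg hA]
  simp only [Matrix.smul_mul, neg_mul, smul_neg, mul_neg, mul_add, smul_add, mul_assoc, neg_neg,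
    neg_add]

theorem contDiff_doubleWronskian {k : WithTop ℕ∞} (p : ℕ) {A : Matrix (Fin N) (Fin N) 𝕜}
    (hA : IsUnit A.det) (C D : Fin N → 𝕜) :
    ContDiff ℝ k (fun z : ℝ × ℝ => doubleWronskian p (phi A C) (psi A D) z.1 z.2) := by
  simp_rw [doubleWronskian_eq_det p hA, wMat_eq p hA, Matrix.det_apply']
  refine ContDiff.sum fun σ _ => contDiff_const.mul (contDiff_prod fun i _ => ?_)
  simp only [Matrix.add_apply, Matrix.mul_apply]
  exact (ContDiff.sum fun j _ => (contDiff_expMat_apply A _ _).mul contDiff_const).add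
    (ContDiff.sum fun j _ => (contDiff_expMat_apply (-A) _ _).mul contDiff_const)

end Evolution

/-! ### The Lax system for `B` and `L` -/

section Lax

open scoped Matrix.Norms.Operator

variable {𝕜 : Type*} [RCLike 𝕜] {N : ℕ}

theorem signMat_mul_self (R : Type*) [CommRing R] (N p : ℕ) :
    signMat R N p * signMat R N p = 1 := by
  rw [signMat, Matrix.diagonal_mul_diagonal, ← Matrix.diagonal_one]
  congr 1
  funext j
  split_ifs <;> simp

/-- The matrix of `A` in the basis of the columns of the double Wronskian. -/
noncomputable def laxB (p : ℕ) (A : Matrix (Fin N) (Fin N) 𝕜) (C D : Fin N → 𝕜) (x t : ℝ) :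
    Matrix (Fin N) (Fin N) 𝕜 :=
  conjMat p A (phi A C x t) (psi A D x t)

/-- The matrix `B⁻¹ J B`. -/
noncomputable def laxL (p : ℕ) (A : Matrix (Fin N) (Fin N) 𝕜) (C D : Fin N → 𝕜) (x t : ℝ) :
    Matrix (Fin N) (Fin N) 𝕜 :=
  (laxB p A C D x t)⁻¹ * signMat 𝕜 N p * laxB p A C D x t

variable {p : ℕ} {A : Matrix (Fin N) (Fin N) 𝕜} {C D : Fin N → 𝕜} {x t : ℝ}

theorem isUnit_det_laxB (hA : IsUnit A.det) (hW : IsUnit (wMat p A C D x t).det) :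
    IsUnit (laxB p A C D x t).det := by
  rw [laxB, conjMat, Matrix.det_mul, Matrix.det_mul]
  exact ((Matrix.isUnit_nonsing_inv_det _ hW).mul hA).mul hW

theorem laxB_mul_laxL (hA : IsUnit A.det) (hW : IsUnit (wMat p A C D x t).det) :
    laxB p A C D x t * laxL p A C D x t = signMat 𝕜 N p * laxB p A C D x t := by
  rw [laxL, mul_assoc, Matrix.mul_nonsing_inv_cancel_left _ _ (isUnit_det_laxB hA hW)]

/-- `W⁻¹ W_x = -B J`, so `B_x = [B, -B J]`. -/
theorem hasDerivAt_laxB_x (hA : IsUnit A.det) (hW : IsUnit (wMat p A C D x t).det) :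
    HasDerivAt (fun ξ => laxB p A C D ξ t)
      (laxB p A C D x t * (signMat 𝕜 N p * laxB p A C D x t - laxB p A C D x t * signMat 𝕜 N p))
      x := by
  refine (hasDerivAt_conj (A := A) (hasDerivAt_wMat_x p hA C D x t) hW).congr_deriv ?_
  have h : laxB p A C D x t = (wMat p A C D x t)⁻¹ * A * wMat p A C D x t := rfl
  rw [h]
  generalize hG : wMat p A C D x t = W at *
  have h1 : W * (W⁻¹ * A * W) = A * W := by
    rw [mul_assoc W⁻¹, Matrix.mul_nonsing_inv_cancel_left _ _ hW]
  have h2 : W⁻¹ * A * (A * W * signMat 𝕜 N p) =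
      W⁻¹ * A * W * (W⁻¹ * A * W * signMat 𝕜 N p) := by
    rw [← h1]
    simp only [mul_assoc]
  rw [mul_neg, h2]
  noncomm_ring

/-- `W⁻¹ W_t = -(1/4) B⁻¹ J`, so `B_t = [B, -(1/4) B⁻¹ J]`. -/
theorem hasDerivAt_laxB_t (hA : IsUnit A.det) (hW : IsUnit (wMat p A C D x t).det) :
    HasDerivAt (fun τ => laxB p A C D x τ)
      ((1 / 4 : ℝ) • (laxL p A C D x t - signMat 𝕜 N p)) t := by
  refine (hasDerivAt_conj (A := A) (hasDerivAt_wMat_t p hA C D x t) hW).congr_deriv ?_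
  have h : laxB p A C D x t = (wMat p A C D x t)⁻¹ * A * wMat p A C D x t := rfl
  rw [laxL, h]
  generalize hG : wMat p A C D x t = W at *
  have h1 : W⁻¹ * A * (A⁻¹ * W * signMat 𝕜 N p) = signMat 𝕜 N p := by
    rw [mul_assoc, mul_assoc A⁻¹, Matrix.mul_nonsing_inv_cancel_left _ _ hA,
      Matrix.nonsing_inv_mul_cancel_left _ _ hW]
  have h2 : (W⁻¹ * A * W)⁻¹ = W⁻¹ * (A⁻¹ * W) := by
    rw [Matrix.mul_inv_rev, Matrix.mul_inv_rev, Matrix.nonsing_inv_nonsing_inv _ hW]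
  rw [h2]
  simp only [mul_neg, neg_mul, Matrix.mul_smul, Matrix.smul_mul, h1, sub_neg_eq_add, smul_sub]
  simp only [mul_assoc]
  abel

theorem hasDerivAt_laxL_x (hA : IsUnit A.det) (hW : IsUnit (wMat p A C D x t).det) :
    HasDerivAt (fun ξ => laxL p A C D ξ t)
      (laxL p A C D x t *
        (signMat 𝕜 N p * laxB p A C D x t - laxB p A C D x t * signMat 𝕜 N p) -
      (signMat 𝕜 N p * laxB p A C D x t - laxB p A C D x t * signMat 𝕜 N p) *
        laxL p A C D x t) x := by
  have hB := isUnit_det_laxB hA hW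
  refine (hasDerivAt_conj (A := signMat 𝕜 N p) (hasDerivAt_laxB_x hA hW) hB).congr_deriv ?_
  rw [laxL]
  congr 1
  · simp only [mul_assoc]
  · rw [Matrix.nonsing_inv_mul_cancel_left _ _ hB]

/-- Differentiating the formula for `B_x` in `t` and simplifying with `J² = 1` and `B L = J B` gives
a quarter of `L_x`, without exchanging partial derivatives. -/
theorem hasDerivAt_laxB_xt (hA : IsUnit A.det) (hW : IsUnit (wMat p A C D x t).det) :
    HasDerivAt (fun τ => laxB p A C D x τ *
        (signMat 𝕜 N p * laxB p A C D x τ - laxB p A C D x τ * signMat 𝕜 N p))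
      ((1 / 4 : ℝ) • (laxL p A C D x t *
        (signMat 𝕜 N p * laxB p A C D x t - laxB p A C D x t * signMat 𝕜 N p) -
      (signMat 𝕜 N p * laxB p A C D x t - laxB p A C D x t * signMat 𝕜 N p) *
        laxL p A C D x t)) t := by
  have hB := hasDerivAt_laxB_t hA hW
  refine (hB.mul ((hB.const_mul (signMat 𝕜 N p)).sub (hB.mul_const _))).congr_deriv ?_
  simp only [Pi.sub_apply]
  have h1 := signMat_mul_self 𝕜 N p
  have h2 := laxB_mul_laxL hA hW
  generalize laxB p A C D x t = B at *
  generalize laxL p A C D x t = L at *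
  generalize signMat 𝕜 N p = J at *
  have h3 : J * (B * L) = B := by rw [h2, ← mul_assoc, h1, one_mul]
  have h4 : J * (J * B) = B := by rw [← mul_assoc, h1, one_mul]
  have h5 : B * (L * J) = J * (B * J) := by rw [← mul_assoc, h2, mul_assoc]
  simp only [Matrix.smul_mul, Matrix.mul_smul, ← smul_sub, ← smul_add]
  congr 1
  simp only [mul_sub, sub_mul, mul_assoc, h1, h3, h4, h5]
  abel

end Lax

end SineGordon

namespace SineGordon

/-! ### Entries of the Lax system and the solution of (2) -/

section Solutions

open scoped Matrix.Norms.Operator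

variable {𝕜 : Type*} [RCLike 𝕜] {n : ℕ}
  {A : Matrix (Fin ((n + 1) + (n + 1))) (Fin ((n + 1) + (n + 1))) 𝕜}
  {C D : Fin ((n + 1) + (n + 1)) → 𝕜}

theorem fW_eq_det (hA : IsUnit A.det) (x t : ℝ) :
    fW (phi A C) (psi A D) x t = (wMat (n + 1) A C D x t).det :=
  doubleWronskian_eq_det _ hA C D x t

theorem isUnit_of_mem_regularSet (hA : IsUnit A.det) {x t : ℝ}
    (h : (x, t) ∈ regularSet (phi A C) (psi A D)) : IsUnit (wMat (n + 1) A C D x t).det := by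
  rw [isUnit_iff_ne_zero, ← fW_eq_det hA]
  exact h

theorem isOpen_regularSet (hA : IsUnit A.det) : IsOpen (regularSet (phi A C) (psi A D)) :=
  isOpen_ne_fun (contDiff_doubleWronskian (k := 0) (n + 1) hA C D).continuous continuous_const

theorem eventually_mem_x {U : Set (ℝ × ℝ)} (hU : IsOpen U) {x t : ℝ} (h : (x, t) ∈ U) :
    ∀ᶠ ξ in 𝓝 x, (ξ, t) ∈ U :=
  (Continuous.prodMk continuous_id continuous_const).continuousAt.eventually (hU.mem_nhds h)

theorem eventually_mem_t {U : Set (ℝ × ℝ)} (hU : IsOpen U) {x t : ℝ} (h : (x, t) ∈ U) :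
    ∀ᶠ τ in 𝓝 t, (x, τ) ∈ U :=
  (Continuous.prodMk continuous_const continuous_id).continuousAt.eventually (hU.mem_nhds h)

theorem isC2On_qW (hA : IsUnit A.det) :
    IsC2On (regularSet (phi A C) (psi A D)) (qW (phi A C) (psi A D)) := by
  intro z hz
  simp only [qW, div_eq_mul_inv]
  exact ((contDiff_const.mul (contDiff_doubleWronskian n hA C D)).contDiffAt.mul
    ((contDiff_doubleWronskian (n + 1) hA C D).contDiffAt.inv hz)).contDiffWithinAt

theorem isC2On_rW (hA : IsUnit A.det) :
    IsC2On (regularSet (phi A C) (psi A D)) (rW (phi A C) (psi A D)) := by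
  intro z hz
  simp only [rW, div_eq_mul_inv]
  exact ((contDiff_const.mul (contDiff_doubleWronskian (n + 2) hA C D)).neg.contDiffAt.mul
    ((contDiff_doubleWronskian (n + 1) hA C D).contDiffAt.inv hz)).contDiffWithinAt

variable {x t : ℝ}

theorem qW_eq (hA : IsUnit A.det) (h : (x, t) ∈ regularSet (phi A C) (psi A D)) :
    qW (phi A C) (psi A D) x t =
      -2 * (-1) ^ n * laxB (n + 1) A C D x t (idxL n) (idxR n) := by
  have hW := isUnit_of_mem_regularSet hA h
  have hf := hW.ne_zero
  rw [qW, SineGordon.hW, fW_eq_det hA, doubleWronskian_eq_det _ hA]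
  rw [wMat, det_colMat_pred hW, div_eq_iff hf, laxB, wMat]
  ring

theorem rW_eq (hA : IsUnit A.det) (h : (x, t) ∈ regularSet (phi A C) (psi A D)) :
    rW (phi A C) (psi A D) x t =
      2 * (-1) ^ n * laxB (n + 1) A C D x t (idxR n) (idxL n) := by
  have hW := isUnit_of_mem_regularSet hA h
  have hf := hW.ne_zero
  rw [rW, gW, fW_eq_det hA, doubleWronskian_eq_det _ hA]
  rw [wMat, det_colMat_succ hW, div_eq_iff hf, laxB, wMat]
  ring

/-- Jacobi's formula applied to `W_x = -W (B J)`. -/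
theorem dx_fW (hA : IsUnit A.det) (h : (x, t) ∈ regularSet (phi A C) (psi A D)) :
    dx (fW (phi A C) (psi A D)) x t / fW (phi A C) (psi A D) x t =
      -(laxB (n + 1) A C D x t * signMat 𝕜 ((n + 1) + (n + 1)) (n + 1)).trace := by
  have hW := isUnit_of_mem_regularSet hA h
  have hd := hasDerivAt_det_mul (M := fun ξ => wMat (n + 1) A C D ξ t) (x := x)
    (X := -(laxB (n + 1) A C D x t * signMat 𝕜 ((n + 1) + (n + 1)) (n + 1))) ?_
  · rw [dx]
    simp_rw [fW_eq_det hA]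
    rw [hd.deriv, mul_div_cancel_left₀ _ hW.ne_zero, Matrix.trace_neg]
  · intro i j
    refine (hasDerivAt_entry (hasDerivAt_wMat_x (n + 1) hA C D x t) i j).congr_deriv ?_
    have h1 : wMat (n + 1) A C D x t * laxB (n + 1) A C D x t = A * wMat (n + 1) A C D x t := by
      change wMat (n + 1) A C D x t * ((wMat (n + 1) A C D x t)⁻¹ * A * wMat (n + 1) A C D x t) = _
      rw [mul_assoc, Matrix.mul_nonsing_inv_cancel_left _ _ hW]
    rw [mul_neg, ← mul_assoc, h1]

section Entries

theorem laxB_apply_zero (hA : IsUnit A.det) (h : (x, t) ∈ regularSet (phi A C) (psi A D))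
    (i j : Fin ((n + 1) + (n + 1))) (hn : j ≠ idxL n) (hm : j ≠ idxR n) :
    (if (i : ℕ) < n + 1 then (1 : 𝕜) else -1) * laxB (n + 1) A C D x t i j =
      (if (j : ℕ) < n + 1 then (1 : 𝕜) else -1) * laxB (n + 1) A C D x t i j :=
  conjMat_apply_zero (isUnit_of_mem_regularSet hA h) i j hn hm

theorem lax_bracket_apply (hA : IsUnit A.det) (h : (x, t) ∈ regularSet (phi A C) (psi A D))
    (p q : Fin ((n + 1) + (n + 1))) (hp : p = idxL n ∨ p = idxR n) {dp dq : 𝕜}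
    (hdp : (if (p : ℕ) < n + 1 then (1 : 𝕜) else -1) = dp)
    (hdq : (if (q : ℕ) < n + 1 then (1 : 𝕜) else -1) = dq) :
    (laxL (n + 1) A C D x t * (signMat 𝕜 ((n + 1) + (n + 1)) (n + 1) * laxB (n + 1) A C D x t -
        laxB (n + 1) A C D x t * signMat 𝕜 ((n + 1) + (n + 1)) (n + 1)) -
      (signMat 𝕜 ((n + 1) + (n + 1)) (n + 1) * laxB (n + 1) A C D x t -
        laxB (n + 1) A C D x t * signMat 𝕜 ((n + 1) + (n + 1)) (n + 1)) * laxL (n + 1) A C D x t) p q =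
      (laxL (n + 1) A C D x t p (idxL n) * ((1 - dq) * laxB (n + 1) A C D x t (idxL n) q) +
        laxL (n + 1) A C D x t p (idxR n) * ((-1 - dq) * laxB (n + 1) A C D x t (idxR n) q)) -
      ((dp - 1) * laxB (n + 1) A C D x t p (idxL n) * laxL (n + 1) A C D x t (idxL n) q +
        (dp - -1) * laxB (n + 1) A C D x t p (idxR n) * laxL (n + 1) A C D x t (idxR n) q) := by
  have hB := isUnit_det_laxB hA (isUnit_of_mem_regularSet hA h)
  refine (bracket_apply (J := signMat 𝕜 ((n + 1) + (n + 1)) (n + 1))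
    (L := laxL (n + 1) A C D x t) (idxL_ne_idxR n) rfl hB rfl (laxB_apply_zero hA h) p q hp).trans
    ?_
  rw [hdp, hdq]
  simp [idxL, idxR]

/-- `s = 1/2 + (tr B J)_t = 1/2 + (1/4) tr((L - J) J)`. By `trace_conj_mul`, the constant `1/2` and
the dimension cancel. -/
theorem sW_eq (hA : IsUnit A.det) (h : (x, t) ∈ regularSet (phi A C) (psi A D)) :
    sW (phi A C) (psi A D) x t = (1 / 4 : 𝕜) *
      (laxL (n + 1) A C D x t (idxL n) (idxL n) - laxL (n + 1) A C D x t (idxR n) (idxR n)) := by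
  have hW := isUnit_of_mem_regularSet hA h
  have hB := isUnit_det_laxB hA hW
  have he : (fun τ => dx (fW (phi A C) (psi A D)) x τ / fW (phi A C) (psi A D) x τ) =ᶠ[𝓝 t]
      fun τ => -(laxB (n + 1) A C D x τ * signMat 𝕜 ((n + 1) + (n + 1)) (n + 1)).trace := by
    filter_upwards [eventually_mem_t (isOpen_regularSet hA) h] with τ hτ
    exact dx_fW hA hτ
  have hd := (hasDerivAt_trace ((hasDerivAt_laxB_t hA hW).mul_const
    (signMat 𝕜 ((n + 1) + (n + 1)) (n + 1)))).neg
  rw [sW, dt, he.deriv_eq]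
  have ht := trace_conj_mul (idxL_ne_idxR n) rfl hB rfl (laxB_apply_zero hA h)
    (fun i => by split_ifs <;> simp) (by simp [idxL]) (by simp [idxR])
  erw [hd.deriv]
  change (laxL (n + 1) A C D x t * signMat 𝕜 ((n + 1) + (n + 1)) (n + 1)).trace = _ at ht
  rw [Matrix.smul_mul, Matrix.trace_smul, sub_mul, Matrix.trace_sub, signMat_mul_self,
    Matrix.trace_one, ht, RCLike.real_smul_eq_coe_mul]
  change _ = (1 / 4 : 𝕜) *
      (laxL (n + 1) A C D x t (idxL n) (idxL n) - laxL (n + 1) A C D x t (idxR n) (idxR n))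
  change (1 / 2 : 𝕜) - -(((1 / 4 : ℝ) : 𝕜) * (_ - 2 + (laxL (n + 1) A C D x t (idxL n) (idxL n) -
    laxL (n + 1) A C D x t (idxR n) (idxR n)) - _)) = _
  push_cast
  ring

end Entries

theorem isAKNSSol_doubleWronskian (hA : IsUnit A.det) :
    IsAKNSSol (regularSet (phi A C) (psi A D)) (qW (phi A C) (psi A D)) (rW (phi A C) (psi A D))
      (sW (phi A C) (psi A D)) := by
  refine ⟨isC2On_qW hA, isC2On_rW hA, fun x t h => ?_⟩
  have hU := isOpen_regularSet (C := C) (D := D) hA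
  have hW := isUnit_of_mem_regularSet hA h
  have hdL : (if ((idxL n : Fin _) : ℕ) < n + 1 then (1 : 𝕜) else -1) = 1 := by simp [idxL]
  have hdR : (if ((idxR n : Fin _) : ℕ) < n + 1 then (1 : 𝕜) else -1) = -1 := by simp [idxR]
  have hLL := lax_bracket_apply hA h (idxL n) (idxL n) (Or.inl rfl) hdL hdL
  have hLR := lax_bracket_apply hA h (idxL n) (idxR n) (Or.inl rfl) hdL hdR
  have hRL := lax_bracket_apply hA h (idxR n) (idxL n) (Or.inr rfl) hdR hdL
  have hRR := lax_bracket_apply hA h (idxR n) (idxR n) (Or.inr rfl) hdR hdR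
  have hs : HasDerivAt (fun ξ => sW (phi A C) (psi A D) ξ t) _ x :=
    (((hasDerivAt_entry (hasDerivAt_laxL_x hA hW) (idxL n) (idxL n)).sub
      (hasDerivAt_entry (hasDerivAt_laxL_x hA hW) (idxR n) (idxR n))).const_mul
        (1 / 4 : 𝕜)).congr_of_eventuallyEq (by
      filter_upwards [eventually_mem_x hU h] with ξ hξ
      exact sW_eq hA hξ)
  have hqx : ∀ τ, (x, τ) ∈ regularSet (phi A C) (psi A D) →
      HasDerivAt (fun ξ => qW (phi A C) (psi A D) ξ τ) _ x := fun τ hτ =>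
    ((hasDerivAt_entry (hasDerivAt_laxB_x hA (isUnit_of_mem_regularSet hA hτ)) (idxL n)
      (idxR n)).const_mul (-2 * (-1) ^ n)).congr_of_eventuallyEq (by
      filter_upwards [eventually_mem_x hU hτ] with ξ hξ
      exact qW_eq hA hξ)
  have hrx : ∀ τ, (x, τ) ∈ regularSet (phi A C) (psi A D) →
      HasDerivAt (fun ξ => rW (phi A C) (psi A D) ξ τ) _ x := fun τ hτ =>
    ((hasDerivAt_entry (hasDerivAt_laxB_x hA (isUnit_of_mem_regularSet hA hτ)) (idxR n)
      (idxL n)).const_mul (2 * (-1) ^ n)).congr_of_eventuallyEq (by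
      filter_upwards [eventually_mem_x hU hτ] with ξ hξ
      exact rW_eq hA hξ)
  have hqxt : HasDerivAt (fun τ => dx (qW (phi A C) (psi A D)) x τ) _ t :=
    ((hasDerivAt_entry (hasDerivAt_laxB_xt hA hW) (idxL n)
      (idxR n)).const_mul (-2 * (-1) ^ n)).congr_of_eventuallyEq (by
      filter_upwards [eventually_mem_t hU h] with τ hτ
      exact (hqx τ hτ).deriv)
  have hrxt : HasDerivAt (fun τ => dx (rW (phi A C) (psi A D)) x τ) _ t :=
    ((hasDerivAt_entry (hasDerivAt_laxB_xt hA hW) (idxR n)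
      (idxL n)).const_mul (2 * (-1) ^ n)).congr_of_eventuallyEq (by
      filter_upwards [eventually_mem_t hU h] with τ hτ
      exact (hrx τ hτ).deriv)
  have hqr : HasDerivAt
      (fun τ => prodFun (qW (phi A C) (psi A D)) (rW (phi A C) (psi A D)) x τ) _ t :=
    (((hasDerivAt_entry (hasDerivAt_laxB_t hA hW) (idxL n) (idxR n)).const_mul
      (-2 * (-1) ^ n)).mul ((hasDerivAt_entry (hasDerivAt_laxB_t hA hW) (idxR n)
      (idxL n)).const_mul (2 * (-1) ^ n))).congr_of_eventuallyEq (by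
      filter_upwards [eventually_mem_t hU h] with τ hτ
      rw [prodFun, qW_eq hA hτ, rW_eq hA hτ]
      rfl)
  have hJ1 : signMat 𝕜 ((n + 1) + (n + 1)) (n + 1) (idxL n) (idxR n) = 0 :=
    Matrix.diagonal_apply_ne _ (idxL_ne_idxR n)
  have hJ2 : signMat 𝕜 ((n + 1) + (n + 1)) (n + 1) (idxR n) (idxL n) = 0 :=
    Matrix.diagonal_apply_ne _ (idxL_ne_idxR n).symm
  have hsq : ((-1 : 𝕜) ^ n) * (-1) ^ n = 1 := by rw [← mul_pow]; simp
  refine ⟨hs.differentiableAt, ?_, ?_, ?_⟩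
  · rw [dt, hqxt.deriv, qW_eq hA h, sW_eq hA h, Matrix.smul_apply, hLR,
      RCLike.real_smul_eq_coe_mul]
    push_cast
    ring
  · rw [dt, hrxt.deriv, rW_eq hA h, sW_eq hA h, Matrix.smul_apply, hRL,
      RCLike.real_smul_eq_coe_mul]
    push_cast
    ring
  · rw [dx, hs.deriv, dt, hqr.deriv, hLL, hRR]
    simp only [Matrix.smul_apply, Matrix.sub_apply, hJ1, hJ2, RCLike.real_smul_eq_coe_mul]
    push_cast
    generalize laxL (n + 1) A C D x t = L
    generalize laxB (n + 1) A C D x t = B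
    -- Both sides equal `-(B_lr L_rl + B_rl L_lr)` once `((-1)^n)^2 = 1`.
    linear_combination (B (idxL n) (idxR n) * L (idxR n) (idxL n) +
      B (idxR n) (idxL n) * L (idxL n) (idxR n)) * hsq

end Solutions

end SineGordon

namespace SineGordon

/-! ### The reduction `r(x,t) = -q(σx,σt)` of system (2) -/

section Reduction

variable {𝕜 : Type*} [RCLike 𝕜]

theorem reduction_one (q : ℝ → ℝ → 𝕜) : reduction 1 q = fun x t => -q x t := by
  funext x t; simp [reduction]

theorem reduction_neg_one (q : ℝ → ℝ → 𝕜) : reduction (-1) q = fun x t => -q (-x) (-t) := by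
  funext x t; simp [reduction]

theorem isC2On_reduction (σ : ℝ) {q : ℝ → ℝ → 𝕜} (hq : IsC2On Set.univ q) :
    IsC2On Set.univ (reduction σ q) := by
  rw [IsC2On, contDiffOn_univ] at *
  exact (hq.comp (g := fun p : ℝ × ℝ => q p.1 p.2) (f := fun p : ℝ × ℝ => (σ * p.1, σ * p.2))
    (by fun_prop)).neg

theorem dx_neg_comp_neg (q : ℝ → ℝ → 𝕜) :
    dx (fun x t => -q (-x) (-t)) = fun x t => dx q (-x) (-t) := by
  funext x t
  simp only [dx]
  rw [deriv.fun_neg, deriv_comp_neg (fun ξ => q ξ (-t)) x, neg_neg]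

theorem dt_comp_neg (q : ℝ → ℝ → 𝕜) (x t : ℝ) :
    dt (fun x t => q (-x) (-t)) x t = -dt q (-x) (-t) := by
  simp only [dt]
  rw [deriv_comp_neg (fun τ => q (-x) τ) t]

/-- For `σ = -1` the two sign changes, from `x` and from `t`, cancel. Regularity of `q` plays no
role, since `deriv` commutes with negation and reflection even at its default value. -/
theorem dt_dx_reduction {σ : ℝ} (hσ : σ = 1 ∨ σ = -1) (q : ℝ → ℝ → 𝕜) (x t : ℝ) :
    dt (dx (reduction σ q)) x t = -dt (dx q) (σ * x) (σ * t) := by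
  rcases hσ with rfl | rfl
  · rw [reduction_one]
    simp only [dt, dx, deriv.fun_neg, one_mul]
  · rw [reduction_neg_one, dx_neg_comp_neg, dt_comp_neg]
    simp

theorem hasDerivAt_t_of_isC2On {U : Set (ℝ × ℝ)} (hU : IsOpen U) {q : ℝ → ℝ → 𝕜}
    (hq : IsC2On U q) {x t : ℝ} (h : (x, t) ∈ U) : HasDerivAt (fun τ => q x τ) (dt q x t) t := by
  have h1 : DifferentiableAt ℝ (fun p : ℝ × ℝ => q p.1 p.2) (x, t) :=
    (hq.contDiffAt (hU.mem_nhds h)).differentiableAt (by norm_num)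
  exact (DifferentiableAt.comp (g := fun p : ℝ × ℝ => q p.1 p.2) (f := fun τ : ℝ => (x, τ)) t h1
    (by fun_prop)).hasDerivAt

theorem dt_prodFun_neg {U : Set (ℝ × ℝ)} (hU : IsOpen U) {q r : ℝ → ℝ → 𝕜}
    (hq : IsC2On U q) (hr : ∀ x t, (x, t) ∈ U → r x t = reduction 1 q x t) {x t : ℝ}
    (h : (x, t) ∈ U) : dt (prodFun q r) x t = -(2 * q x t * dt q x t) := by
  have h1 := hasDerivAt_t_of_isC2On hU hq h
  have h2 : (fun τ => prodFun q r x τ) =ᶠ[𝓝 t] fun τ => -(q x τ * q x τ) := by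
    filter_upwards [eventually_mem_t hU h] with τ hτ
    simp [prodFun, hr x τ hτ, reduction]
  rw [dt, h2.deriv_eq, (h1.fun_mul h1).fun_neg.deriv]
  ring

theorem dt_prodFun_reflect {U : Set (ℝ × ℝ)} (hU : IsOpen U) {q r : ℝ → ℝ → 𝕜}
    (hr : ∀ x t, (x, t) ∈ U → r x t = reduction (-1) q x t) {x t : ℝ}
    (h : (x, t) ∈ U) :
    dt (prodFun q r) x t = -dt (fun ξ τ => q ξ τ * q (-ξ) (-τ)) x t := by
  have h2 : (fun τ => prodFun q r x τ) =ᶠ[𝓝 t] fun τ => -(q x τ * q (-x) (-τ)) := by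
    filter_upwards [eventually_mem_t hU h] with τ hτ
    simp [prodFun, hr x τ hτ, reduction]
  rw [dt, h2.deriv_eq, deriv.fun_neg, dt]

theorem IsAKNSSol.isSGSol {U : Set (ℝ × ℝ)} (hU : IsOpen U) {q r s : ℝ → ℝ → 𝕜}
    (h : IsAKNSSol U q r s) (hr : ∀ x t, (x, t) ∈ U → r x t = reduction 1 q x t) :
    IsSGSol U q s := by
  refine ⟨h.1, fun x t hx => ?_⟩
  obtain ⟨h1, h2, -, h4⟩ := h.2.2 x t hx
  refine ⟨h1, by rw [h2, sub_self], ?_⟩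
  rw [h4, dt_prodFun_neg hU h.1 hr hx]
  ring

theorem IsAKNSSol.isNonlocalSGSol {U : Set (ℝ × ℝ)} (hU : IsOpen U) {q r s : ℝ → ℝ → 𝕜}
    (h : IsAKNSSol U q r s) (hr : ∀ x t, (x, t) ∈ U → r x t = reduction (-1) q x t) :
    IsNonlocalSGSol U q s := by
  refine ⟨h.1, fun x t hx => ?_⟩
  obtain ⟨h1, h2, -, h4⟩ := h.2.2 x t hx
  refine ⟨h1, by rw [h2, sub_self], ?_⟩
  rw [h4, dt_prodFun_reflect hU hr hx]
  ring

theorem IsSGSol.isAKNSSol {q s : ℝ → ℝ → 𝕜} (h : IsSGSol Set.univ q s) :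
    IsAKNSSol Set.univ q (reduction 1 q) s := by
  refine ⟨h.1, isC2On_reduction 1 h.1, fun x t hx => ?_⟩
  obtain ⟨h1, h2, h3⟩ := h.2 x t hx
  refine ⟨h1, sub_eq_zero.1 h2, ?_, ?_⟩
  · rw [dt_dx_reduction (Or.inl rfl), one_mul, one_mul, sub_eq_zero.1 h2, reduction_one]
    ring
  · rw [dt_prodFun_neg isOpen_univ h.1 (fun _ _ _ => rfl) hx]
    linear_combination h3

/-- The equation for `r` at `(x, t)` is the equation for `q` at `(-x, -t)`; this is where evenness
of `s` enters. -/
theorem IsNonlocalSGSol.isAKNSSol {q s : ℝ → ℝ → 𝕜} (h : IsNonlocalSGSol Set.univ q s)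
    (hs : ∀ x t, s (-x) (-t) = s x t) : IsAKNSSol Set.univ q (reduction (-1) q) s := by
  refine ⟨h.1, isC2On_reduction (-1) h.1, fun x t hx => ?_⟩
  obtain ⟨h1, h2, h3⟩ := h.2 x t hx
  refine ⟨h1, sub_eq_zero.1 h2, ?_, ?_⟩
  · have h4 := sub_eq_zero.1 (h.2 (-x) (-t) (Set.mem_univ _)).2.1
    rw [dt_dx_reduction (Or.inr rfl), neg_one_mul, neg_one_mul, h4, hs, reduction_neg_one]
    ring
  · rw [dt_prodFun_reflect isOpen_univ (fun _ _ _ => rfl) hx]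
    linear_combination h3

end Reduction

/-! ### The operator `∂ₓ⁻¹` and the integro-differential form -/

section Integral

variable {𝕜 : Type*} [RCLike 𝕜]

/-- `intOp F` differs from the integral of `F` over `[0, x]` by a constant. -/
theorem hasDerivAt_intOp {F : ℝ → 𝕜} (hc : Continuous F) (hi : Integrable F) (x : ℝ) :
    HasDerivAt (intOp F) (F x) x := by
  have h1 : intOp F = fun x => (∫ y in (0 : ℝ)..x, F y) +
      ((∫ y in Set.Iic 0, F y) - (1 / 2 : 𝕜) * ∫ y, F y) := by
    funext x
    have h2 := intervalIntegral.integral_Iic_sub_Iic (a := 0) (b := x) (f := F) (μ := volume)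
      hi.integrableOn hi.integrableOn
    have h3 := integral_add_compl (measurableSet_Iic (a := x)) hi
    rw [Set.compl_Iic] at h3
    rw [intOp, ← h2, ← h3]
    ring
  rw [h1]
  exact (intervalIntegral.integral_hasDerivAt_right (hc.intervalIntegrable _ _)
    hc.stronglyMeasurable.stronglyMeasurableAtFilter hc.continuousAt).add_const _

theorem intOp_of_odd (F G : ℝ → 𝕜) (h : ∀ y, G (-y) = -F y) (x : ℝ) :
    intOp G (-x) = intOp F x := by
  have h1 : ∫ y in Set.Iic (-x), G y = -∫ y in Set.Ioi x, F y := by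
    rw [← integral_neg, ← integral_comp_neg_Ioi x G]
    simp_rw [h]
  have h2 : ∫ y in Set.Ioi (-x), G y = -∫ y in Set.Iic x, F y := by
    rw [← integral_neg, ← integral_comp_neg_Iic x G]
    simp_rw [h]
  rw [intOp, intOp, h1, h2]
  ring

/-- Half of `(s - a) - (a - s)`: the operator selects the antiderivative whose limits at the two
ends are opposite, hence subtracts a common limit `a`. -/
theorem intOp_of_hasDerivAt {F s : ℝ → 𝕜} {a : 𝕜} (hi : Integrable F)
    (hs : ∀ x, HasDerivAt s (F x) x) (h1 : Tendsto s atTop (𝓝 a)) (h2 : Tendsto s atBot (𝓝 a))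
    (x : ℝ) : intOp F x = s x - a := by
  rw [intOp, integral_Ioi_of_hasDerivAt_of_tendsto' (fun y _ => hs y) hi.integrableOn h1,
    integral_Iic_of_hasDerivAt_of_tendsto' (fun y _ => hs y) hi.integrableOn h2]
  ring

theorem continuous_dt_prodFun {q r : ℝ → ℝ → 𝕜} (hq : IsC2On Set.univ q)
    (hr : IsC2On Set.univ r) (t : ℝ) : Continuous fun y => dt (prodFun q r) y t := by
  rw [IsC2On, contDiffOn_univ] at hq hr
  have h := hq.mul hr
  have h1 : (fun y => dt (prodFun q r) y t) = fun y =>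
      fderiv ℝ (fun p : ℝ × ℝ => q p.1 p.2 * r p.1 p.2) (y, t) (0, 1) := by
    funext y
    have h2 := ((h.differentiable (by norm_num)) (y, t)).hasFDerivAt
    exact (h2.comp_hasDerivAt t ((hasDerivAt_const t y).prodMk (hasDerivAt_id t))).deriv
  rw [h1]
  have h3 := h.continuous_fderiv (by norm_num)
  exact (h3.comp (by fun_prop : Continuous fun y : ℝ => (y, t))).clm_apply continuous_const

/-- The product `q r` is invariant under `(x,t) ↦ (-x,-t)`, so `(q r)_t` is odd, while reflection
exchanges the two half-lines in `∂ₓ⁻¹`. -/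
theorem auxS_neg (q : ℝ → ℝ → 𝕜) (x t : ℝ) :
    auxS q (reduction (-1) q) (-x) (-t) = auxS q (reduction (-1) q) x t := by
  rw [auxS, auxS]
  congr 1
  refine intOp_of_odd _ _ (fun y => ?_) x
  rw [dt_prodFun_reflect isOpen_univ (fun _ _ _ => rfl) (Set.mem_univ _),
    dt_prodFun_reflect isOpen_univ (fun _ _ _ => rfl) (Set.mem_univ _), neg_inj]
  have h := dt_comp_neg (fun ξ τ => q ξ τ * q (-ξ) (-τ)) (-y) (-t)
  simp only [neg_neg] at h
  have h2 : (fun x t => q (-x) (-t) * q x t) = fun ξ τ => q ξ τ * q (-ξ) (-τ) := by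
    funext x t
    ring
  rw [h2] at h
  rw [h]

/-- `2 q (∂ₓ⁻¹(q r)_t + 1/2)` is `2 q ∂ₓ⁻¹(q r)_t + q`, and `s_x = (q r)_t` is automatic. -/
theorem isAKNSIntSol_iff {q r : ℝ → ℝ → 𝕜} (hq : IsC2On Set.univ q)
    (hr : IsC2On Set.univ r) (ha : HasAux q r) :
    IsAKNSIntSol q r ↔ IsAKNSSol Set.univ q r (auxS q r) := by
  constructor
  · rintro ⟨-, -, -, h⟩
    refine ⟨hq, hr, fun x t _ => ?_⟩
    have hd : HasDerivAt (fun ξ => auxS q r ξ t) (dt (prodFun q r) x t) x :=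
      (hasDerivAt_intOp (continuous_dt_prodFun hq hr t) (ha t) x).add_const _
    refine ⟨hd.differentiableAt, ?_, ?_, hd.deriv⟩
    · rw [auxS]; linear_combination (h x t).1
    · rw [auxS]; linear_combination (h x t).2
  · rintro ⟨-, -, h⟩
    refine ⟨hq, hr, ha, fun x t => ?_⟩
    obtain ⟨-, h1, h2, -⟩ := h x t (Set.mem_univ _)
    rw [auxS] at h1 h2
    exact ⟨by linear_combination h1, by linear_combination h2⟩

end Integral

/-! ### The reduction for double Wronskians -/

section WronskianReduction

open scoped Matrix.Norms.Operator

variable {𝕜 : Type*} [RCLike 𝕜] {σ : ℝ}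

/-- `T` intertwines the exponents, at `(σx, σt)` for `φ` and at `(x, t)` for `ψ`; therefore it
intertwines their exponentials. -/
theorem psi_eq_mulVec_phi {N : ℕ} {A T : Matrix (Fin N) (Fin N) 𝕜} (hσ : σ * σ = 1)
    (hA : IsUnit A.det) (hAT : A * T = -(σ • (T * A))) (C : Fin N → 𝕜) (x t : ℝ) :
    psi A (T *ᵥ C) x t = T *ᵥ phi A C (σ * x) (σ * t) := by
  have h1 : A⁻¹ * T = -(σ • (T * A⁻¹)) := by
    have h2 : A⁻¹ * (A * T) * A⁻¹ = A⁻¹ * (-(σ • (T * A))) * A⁻¹ := by rw [hAT]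
    rw [Matrix.nonsing_inv_mul_cancel_left _ _ hA, mul_neg, neg_mul, Matrix.mul_smul,
      Matrix.smul_mul, mul_assoc, mul_assoc, Matrix.mul_nonsing_inv _ hA, mul_one] at h2
    rw [h2, smul_neg, smul_smul, hσ, one_smul, neg_neg]
  have h3 : SemiconjBy T (-((σ * x) • A) - ((σ * t) / 4) • A⁻¹) (x • A + (t / 4) • A⁻¹) := by
    rw [SemiconjBy, mul_sub, mul_neg, Matrix.mul_smul, Matrix.mul_smul, add_mul, Matrix.smul_mul,
      Matrix.smul_mul, hAT, h1, smul_neg, smul_neg, smul_smul, smul_smul, sub_eq_add_neg]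
    congr 3 <;> ring_nf
  have h4 := h3.exp_right
  rw [psi, phi, Matrix.mulVec_mulVec, Matrix.mulVec_mulVec]
  congr 1
  exact h4.eq.symm

variable {n : ℕ} {A T : Matrix (Fin ((n + 1) + (n + 1))) (Fin ((n + 1) + (n + 1))) 𝕜}
  {C : Fin ((n + 1) + (n + 1)) → 𝕜}

theorem Admissible.mul_eq {N : ℕ} {A T : Matrix (Fin N) (Fin N) 𝕜} (h : Admissible σ A T) :
    A * T = -(σ • (T * A)) :=
  eq_neg_of_add_eq_zero_left h.1

theorem mul_self_of_eq_or (hσ : σ = 1 ∨ σ = -1) : σ * σ = 1 := by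
  rcases hσ with rfl | rfl <;> norm_num

theorem Admissible.mul_eq_coe {N : ℕ} {A T : Matrix (Fin N) (Fin N) 𝕜} (h : Admissible σ A T) :
    A * T = -((σ : 𝕜) • (T * A)) := by
  rw [h.mul_eq]
  ext i j
  simp [RCLike.real_smul_eq_coe_mul]

theorem Admissible.mul_self_eq_coe {N : ℕ} {A T : Matrix (Fin N) (Fin N) 𝕜}
    (h : Admissible σ A T) : T * T = -((σ : 𝕜) • 1) := by
  rw [← pow_two, h.2]
  ext i j
  simp [RCLike.real_smul_eq_coe_mul]

theorem psi_reflect (hσ : σ = 1 ∨ σ = -1) (hA : IsUnit A.det) (hT : Admissible σ A T) (x t : ℝ) :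
    psi A (T *ᵥ C) (σ * x) (σ * t) = T *ᵥ phi A C x t := by
  have h := mul_self_of_eq_or hσ
  rw [psi_eq_mulVec_phi h hA hT.mul_eq, ← mul_assoc, ← mul_assoc, h, one_mul, one_mul]

theorem fW_reflect (hσ : σ = 1 ∨ σ = -1) (hA : IsUnit A.det) (hT : Admissible σ A T) (x t : ℝ) :
    fW (phi A C) (psi A (T *ᵥ C)) (σ * x) (σ * t) =
      (T.det * (swapMat n (σ : 𝕜)).det) * fW (phi A C) (psi A (T *ᵥ C)) x t := by
  have h := mul_self_of_eq_or hσ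
  have h' : (σ : 𝕜) * σ = 1 := by exact_mod_cast congrArg (fun y : ℝ => (y : 𝕜)) h
  rw [fW_eq_det hA, fW_eq_det hA, wMat, wMat, colMat_reflect h' hT.mul_eq_coe hT.mul_self_eq_coe
    (psi_eq_mulVec_phi h hA hT.mul_eq C x t) (psi_reflect hσ hA hT x t), Matrix.det_mul,
    Matrix.det_mul]
  ring

theorem mem_regularSet_reflect (hσ : σ = 1 ∨ σ = -1) (hA : IsUnit A.det) (hT : Admissible σ A T)
    (x t : ℝ) : (σ * x, σ * t) ∈ regularSet (phi A C) (psi A (T *ᵥ C)) ↔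
      (x, t) ∈ regularSet (phi A C) (psi A (T *ᵥ C)) := by
  have h := mul_self_of_eq_or hσ
  have key : ∀ x t : ℝ, (σ * x, σ * t) ∈ regularSet (phi A C) (psi A (T *ᵥ C)) →
      (x, t) ∈ regularSet (phi A C) (psi A (T *ᵥ C)) := by
    intro x t hx
    simp only [regularSet, Set.mem_ofPred_eq, fW_reflect hσ hA hT] at hx ⊢
    exact right_ne_zero_of_mul hx
  refine ⟨key x t, fun hx => key _ _ ?_⟩
  rwa [← mul_assoc, ← mul_assoc, h, one_mul, one_mul]

theorem rW_eq_reduction (hσ : σ = 1 ∨ σ = -1) (hA : IsUnit A.det) (hT : Admissible σ A T)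
    {x t : ℝ} (hx : (x, t) ∈ regularSet (phi A C) (psi A (T *ᵥ C))) :
    rW (phi A C) (psi A (T *ᵥ C)) x t =
      reduction σ (qW (phi A C) (psi A (T *ᵥ C))) x t := by
  have h := mul_self_of_eq_or hσ
  have h' : (σ : 𝕜) * σ = 1 := by exact_mod_cast congrArg (fun y : ℝ => (y : 𝕜)) h
  have hx' := (mem_regularSet_reflect hσ hA hT x t).2 hx
  rw [reduction, rW_eq hA hx, qW_eq hA hx', laxB, laxB,
    conjMat_reflect h' hT.mul_eq_coe hT.mul_self_eq_coe
    (psi_eq_mulVec_phi h hA hT.mul_eq C x t) (psi_reflect hσ hA hT x t)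
    (isUnit_of_mem_regularSet hA hx) (isUnit_of_mem_regularSet hA hx')]
  ring

/-- For `σ = -1`, `f(-x,-t)` is a constant nonzero multiple of `f`. The constant drops out of `f_x /
f`, which is then odd, and its `t`-derivative is even. -/
theorem sW_reflect (hσ : σ = 1 ∨ σ = -1) (hA : IsUnit A.det) (hT : Admissible σ A T)
    {x t : ℝ} (hx : (x, t) ∈ regularSet (phi A C) (psi A (T *ᵥ C))) :
    sW (phi A C) (psi A (T *ᵥ C)) (σ * x) (σ * t) = sW (phi A C) (psi A (T *ᵥ C)) x t := by
  have hf := fW_reflect (C := C) hσ hA hT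
  have hx' := (mem_regularSet_reflect hσ hA hT x t).2 hx
  rcases hσ with rfl | rfl
  · simp
  simp only [regularSet, Set.mem_ofPred_eq] at hx'
  rw [hf] at hx'
  have hc := left_ne_zero_of_mul hx'
  set c := T.det * (swapMat n (((-1 : ℝ)) : 𝕜)).det
  set f := fW (phi A C) (psi A (T *ᵥ C))
  simp only [neg_one_mul] at hf ⊢
  have hdx : ∀ x t : ℝ, dx f (-x) (-t) = -(c * dx f x t) := by
    intro x t
    have h1 : (fun ξ => f (-ξ) (-t)) = fun ξ => c * f ξ t := funext fun ξ => hf ξ t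
    have h2 := deriv_comp_neg (fun ξ => f ξ (-t)) x
    rw [h1, deriv_const_mul_field] at h2
    rw [dx, dx, h2, neg_neg]
  have h3 := dt_comp_neg (fun ξ τ => dx f ξ τ / f ξ τ) x t
  have h4 : (fun ξ τ => dx f (-ξ) (-τ) / f (-ξ) (-τ)) = fun ξ τ => -(dx f ξ τ / f ξ τ) := by
    funext ξ τ
    rw [hdx, hf, neg_div, mul_div_mul_left _ _ hc]
  rw [h4] at h3
  have h5 : dt (fun ξ τ => dx f ξ τ / f ξ τ) (-x) (-t) = dt (fun ξ τ => dx f ξ τ / f ξ τ) x t := by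
    rw [← neg_inj, ← h3]
    simp only [dt, deriv.fun_neg]
  rw [sW, sW]
  exact congrArg (fun y => (1 / 2 : 𝕜) - y) h5

theorem sW_eq_auxS (hσ : σ = 1 ∨ σ = -1) (hA : IsUnit A.det) (hT : Admissible σ A T)
    (hU : regularSet (phi A C) (psi A (T *ᵥ C)) = Set.univ)
    (ha : HasAux (qW (phi A C) (psi A (T *ᵥ C))) (reduction σ (qW (phi A C) (psi A (T *ᵥ C)))))
    (hs : ∀ t : ℝ, Tendsto (fun x => sW (phi A C) (psi A (T *ᵥ C)) x t) atTop (𝓝 (1 / 2)) ∧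
      Tendsto (fun x => sW (phi A C) (psi A (T *ᵥ C)) x t) atBot (𝓝 (1 / 2))) :
    sW (phi A C) (psi A (T *ᵥ C)) = auxS (qW (phi A C) (psi A (T *ᵥ C)))
        (reduction σ (qW (phi A C) (psi A (T *ᵥ C)))) ∧
      IsAKNSIntSol (qW (phi A C) (psi A (T *ᵥ C)))
        (reduction σ (qW (phi A C) (psi A (T *ᵥ C)))) := by
  have hr : rW (phi A C) (psi A (T *ᵥ C)) = reduction σ (qW (phi A C) (psi A (T *ᵥ C))) := by
    funext x t
    exact rW_eq_reduction hσ hA hT (hU ▸ Set.mem_univ _)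
  have hsol := isAKNSSol_doubleWronskian (C := C) (D := T *ᵥ C) hA
  rw [hU, hr] at hsol
  have h1 : sW (phi A C) (psi A (T *ᵥ C)) = auxS (qW (phi A C) (psi A (T *ᵥ C)))
        (reduction σ (qW (phi A C) (psi A (T *ᵥ C)))) := by
    funext x t
    rw [auxS, intOp_of_hasDerivAt (a := 1 / 2) (ha t) (fun y => ?_) (hs t).1 (hs t).2 x]
    · ring
    · obtain ⟨h1, -, -, h2⟩ := hsol.2.2 y t (Set.mem_univ _)
      rw [← h2]
      exact h1.hasDerivAt
  refine ⟨h1, ?_⟩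
  rw [h1] at hsol
  exact (isAKNSIntSol_iff hsol.1 hsol.2.1 ha).2 hsol

end WronskianReduction

end SineGordon

namespace SineGordon

/-! ### Block matrices and their exponentials -/

section Blocks

variable {𝕜 : Type*} [RCLike 𝕜] {n : ℕ}

theorem blocks_mul (M₁ M₂ M₃ M₄ N₁ N₂ N₃ N₄ : Matrix (Fin (n + 1)) (Fin (n + 1)) 𝕜) :
    blocks M₁ M₂ M₃ M₄ * blocks N₁ N₂ N₃ N₄ =
      blocks (M₁ * N₁ + M₂ * N₃) (M₁ * N₂ + M₂ * N₄) (M₃ * N₁ + M₄ * N₃) (M₃ * N₂ + M₄ * N₄) := by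
  simp only [blocks, Matrix.reindex_apply, Matrix.submatrix_mul_equiv, Matrix.fromBlocks_multiply]

theorem blocks_add (M₁ M₂ M₃ M₄ N₁ N₂ N₃ N₄ : Matrix (Fin (n + 1)) (Fin (n + 1)) 𝕜) :
    blocks M₁ M₂ M₃ M₄ + blocks N₁ N₂ N₃ N₄ =
      blocks (M₁ + N₁) (M₂ + N₂) (M₃ + N₃) (M₄ + N₄) := by
  simp only [blocks, Matrix.reindex_apply, ← Matrix.fromBlocks_add, Matrix.submatrix_add,
    Pi.add_apply]

theorem blocks_smul {𝕜 R : Type*} [Zero 𝕜] [SMul R 𝕜] (a : R)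
    (M₁ M₂ M₃ M₄ : Matrix (Fin (n + 1)) (Fin (n + 1)) 𝕜) :
    a • blocks M₁ M₂ M₃ M₄ = blocks (a • M₁) (a • M₂) (a • M₃) (a • M₄) := by
  simp only [blocks, Matrix.reindex_apply, ← Matrix.fromBlocks_smul, Matrix.submatrix_smul,
    Pi.smul_apply]

theorem blocks_neg (M₁ M₂ M₃ M₄ : Matrix (Fin (n + 1)) (Fin (n + 1)) 𝕜) :
    -blocks M₁ M₂ M₃ M₄ = blocks (-M₁) (-M₂) (-M₃) (-M₄) := by
  simp only [blocks, Matrix.reindex_apply, ← Matrix.fromBlocks_neg, Matrix.submatrix_neg,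
    Pi.neg_apply]

theorem blocks_zero : blocks (0 : Matrix (Fin (n + 1)) (Fin (n + 1)) 𝕜) 0 0 0 = 0 := by
  simp [blocks, Matrix.fromBlocks_zero]

theorem blocks_one : blocks (1 : Matrix (Fin (n + 1)) (Fin (n + 1)) 𝕜) 0 0 1 = 1 := by
  simp [blocks, Matrix.fromBlocks_one]

theorem blocks_diag_mulVec_append (M M' : Matrix (Fin (n + 1)) (Fin (n + 1)) 𝕜)
    (c d : Fin (n + 1) → 𝕜) :
    blocks M 0 0 M' *ᵥ Fin.append c d = Fin.append (M *ᵥ c) (M' *ᵥ d) := by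
  funext i
  refine Fin.addCases (fun i => ?_) (fun i => ?_) i
  · rw [Matrix.mulVec, dotProduct, Fin.sum_univ_add]
    simp only [blocks, Matrix.reindex_apply, Matrix.submatrix_apply,
      finSumFinEquiv_symm_apply_castAdd, finSumFinEquiv_symm_apply_natAdd,
      Matrix.fromBlocks_apply₁₁, Matrix.fromBlocks_apply₁₂, Fin.append_left, Fin.append_right,
      Matrix.zero_apply, zero_mul, Finset.sum_const_zero, add_zero]
    rfl
  · rw [Matrix.mulVec, dotProduct, Fin.sum_univ_add]
    simp only [blocks, Matrix.reindex_apply, Matrix.submatrix_apply,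
      finSumFinEquiv_symm_apply_castAdd, finSumFinEquiv_symm_apply_natAdd,
      Matrix.fromBlocks_apply₂₁, Matrix.fromBlocks_apply₂₂, Fin.append_left, Fin.append_right,
      Matrix.zero_apply, zero_mul, Finset.sum_const_zero, zero_add]
    rfl

theorem admissible_blockTPlus (K : Matrix (Fin (n + 1)) (Fin (n + 1)) 𝕜) :
    Admissible 1 (blockA K) (blockTPlus 𝕜 n) := by
  constructor
  · simp only [blockA, blockTPlus, one_smul, blocks_mul, blocks_add]
    simp [blocks_zero]
  · rw [pow_two, one_smul, blockTPlus, blocks_mul, ← blocks_one, blocks_neg]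
    simp

theorem admissible_blockTMinus (K : Matrix (Fin (n + 1)) (Fin (n + 1)) 𝕜) :
    Admissible (-1) (blockA K) (blockTMinus 𝕜 n) := by
  constructor
  · simp only [blockA, blockTMinus, neg_one_smul, blocks_mul, blocks_add, blocks_neg]
    simp [blocks_zero]
  · rw [pow_two, neg_one_smul, neg_neg, blockTMinus, blocks_mul, ← blocks_one]
    simp

/-- The repetition of a diagonal block as a ring homomorphism. -/
def blockHom (𝕜 : Type*) [RCLike 𝕜] (n : ℕ) : Matrix (Fin (n + 1)) (Fin (n + 1)) 𝕜 →+*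
    Matrix (Fin ((n + 1) + (n + 1))) (Fin ((n + 1) + (n + 1))) 𝕜 where
  toFun M := blocks M 0 0 M
  map_one' := blocks_one
  map_mul' M M' := by simp [blocks_mul]
  map_zero' := blocks_zero
  map_add' M M' := by simp [blocks_add]

theorem blockA_mul_inv {K : Matrix (Fin (n + 1)) (Fin (n + 1)) 𝕜} (hK : IsUnit K.det) :
    blockA K * blockA K⁻¹ = 1 := by
  rw [blockA, blockA, blocks_mul, ← blocks_one]
  simp [Matrix.mul_nonsing_inv _ hK]

theorem isUnit_det_blockA {K : Matrix (Fin (n + 1)) (Fin (n + 1)) 𝕜} (hK : IsUnit K.det) :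
    IsUnit (blockA K).det :=
  Matrix.isUnit_det_of_right_inverse (blockA_mul_inv hK)

theorem blockA_inv {K : Matrix (Fin (n + 1)) (Fin (n + 1)) 𝕜} (hK : IsUnit K.det) :
    (blockA K)⁻¹ = blockA K⁻¹ :=
  Matrix.inv_eq_right_inv (blockA_mul_inv hK)

section ExpBlocks

open scoped Matrix.Norms.Operator

theorem exp_blocks_self (M : Matrix (Fin (n + 1)) (Fin (n + 1)) 𝕜) :
    NormedSpace.exp (blocks M 0 0 M) = blocks (NormedSpace.exp M) 0 0 (NormedSpace.exp M) := by
  let _ : NormedAlgebra ℚ (Matrix (Fin (n + 1)) (Fin (n + 1)) 𝕜) :=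
    NormedAlgebra.restrictScalars ℚ ℝ _
  let _ : NormedAlgebra ℚ (Matrix (Fin (n + 1 + (n + 1))) (Fin (n + 1 + (n + 1))) 𝕜) :=
    NormedAlgebra.restrictScalars ℚ ℝ _
  -- A continuous ring homomorphism commutes with `exp`; entrywise continuity suffices.
  have hc : Continuous (blockHom 𝕜 n) := by
    refine continuous_matrix fun i j => ?_
    change Continuous fun P : Matrix (Fin (n + 1)) (Fin (n + 1)) 𝕜 => blocks P 0 0 P i j
    refine Fin.addCases (fun i => ?_) (fun i => ?_) i <;>
    refine Fin.addCases (fun j => ?_) (fun j => ?_) j <;>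
    · simp [blocks]
      try fun_prop
  exact (NormedSpace.map_exp (blockHom 𝕜 n) hc M).symm

/-- The two block projections intertwine the repeated-block matrices with the mixed one, and they
add up to the identity. -/
theorem exp_blocks (M M' : Matrix (Fin (n + 1)) (Fin (n + 1)) 𝕜) :
    NormedSpace.exp (blocks M 0 0 M') = blocks (NormedSpace.exp M) 0 0 (NormedSpace.exp M') := by
  let _ : NormedAlgebra ℚ (Matrix (Fin (n + 1 + (n + 1))) (Fin (n + 1 + (n + 1))) 𝕜) :=
    NormedAlgebra.restrictScalars ℚ ℝ _
  have h1 : SemiconjBy (blocks 1 0 0 0) (blocks M 0 0 M) (blocks M 0 0 M') := by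
    simp [SemiconjBy, blocks_mul]
  have h2 : SemiconjBy (blocks 0 0 0 1) (blocks M' 0 0 M') (blocks M 0 0 M') := by
    simp [SemiconjBy, blocks_mul]
  have h3 : blocks 1 0 0 0 + blocks 0 0 0 1 = (1 : Matrix (Fin (n + 1 + (n + 1))) _ 𝕜) := by
    rw [blocks_add, ← blocks_one]; simp
  calc NormedSpace.exp (blocks M 0 0 M')
      = NormedSpace.exp (blocks M 0 0 M') * (blocks 1 0 0 0 + blocks 0 0 0 1) := by
        rw [h3, mul_one]
    _ = blocks 1 0 0 0 * NormedSpace.exp (blocks M 0 0 M) +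
        blocks 0 0 0 1 * NormedSpace.exp (blocks M' 0 0 M') := by
        rw [mul_add]
        exact congrArg₂ (· + ·) h1.exp_right.eq.symm h2.exp_right.eq.symm
    _ = _ := by
        rw [exp_blocks_self, exp_blocks_self, blocks_mul, blocks_mul, blocks_add]
        simp

end ExpBlocks

theorem phi_blockA_append {K : Matrix (Fin (n + 1)) (Fin (n + 1)) 𝕜} (hK : IsUnit K.det)
    (c d : Fin (n + 1) → 𝕜) (x t : ℝ) :
    phi (blockA K) (Fin.append c d) x t =
      Fin.append (NormedSpace.exp (-(x • K) - (t / 4) • K⁻¹) *ᵥ c)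
        (NormedSpace.exp (-(-(x • K) - (t / 4) • K⁻¹)) *ᵥ d) := by
  rw [phi, blockA_inv hK, blockA, blockA, sub_eq_add_neg, blocks_smul, blocks_smul, blocks_neg,
    blocks_neg, blocks_add]
  simp only [smul_zero, neg_zero, add_zero]
  rw [exp_blocks, blocks_diag_mulVec_append]
  have h1 : (-K)⁻¹ = -K⁻¹ := matrix_inv_neg hK
  have h2 : -(x • -K) + -((t / 4) • (-K⁻¹)) = -(-(x • K) - (t / 4) • K⁻¹) := by
    simp only [smul_neg, neg_neg, neg_sub, sub_neg_eq_add]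
    abel
  rw [h2, ← sub_eq_add_neg]

end Blocks

/-! ### Explicit `φ` for diagonal `K` -/

section Diagonal

variable {𝕜 : Type*} [RCLike 𝕜] {n : ℕ}

theorem isUnit_det_diagonal {k : Fin (n + 1) → 𝕜} (hk : ∀ i, k i ≠ 0) :
    IsUnit (Matrix.diagonal k).det := by
  rw [Matrix.det_diagonal, isUnit_iff_ne_zero]
  exact Finset.prod_ne_zero_iff.2 fun i _ => hk i

theorem neg_expMu_arg (x t : ℝ) (k : 𝕜) :
    -(-k) * (x : 𝕜) - (t : 𝕜) / (4 * -k) = -(-k * (x : 𝕜) - (t : 𝕜) / (4 * k)) := by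
  rw [mul_neg, div_neg]; ring

theorem phi_blockA_diagonal {k : Fin (n + 1) → 𝕜} (hk : ∀ i, k i ≠ 0) (c d : Fin (n + 1) → 𝕜)
    (x t : ℝ) : phi (blockA (Matrix.diagonal k)) (Fin.append c d) x t = phiDiag k c d x t := by
  have hi : (Matrix.diagonal k)⁻¹ = Matrix.diagonal fun i => (k i)⁻¹ := by
    refine Matrix.inv_eq_right_inv ?_
    rw [Matrix.diagonal_mul_diagonal, ← Matrix.diagonal_one]
    congr 1
    funext i
    exact mul_inv_cancel₀ (hk i)
  have hM : -(x • Matrix.diagonal k) - (t / 4) • (Matrix.diagonal k)⁻¹ =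
      Matrix.diagonal fun i => -k i * (x : 𝕜) - (t : 𝕜) / (4 * k i) := by
    rw [hi]
    ext i j
    by_cases h : i = j
    · subst h
      simp only [Matrix.sub_apply, Matrix.neg_apply, Matrix.smul_apply, Matrix.diagonal_apply_eq,
        RCLike.real_smul_eq_coe_mul]
      have := hk i
      push_cast
      field_simp
    · simp [h]
  rw [phi_blockA_append (isUnit_det_diagonal hk), hM, Matrix.diagonal_neg, Matrix.exp_diagonal,
    Matrix.exp_diagonal, phiDiag]
  congr 1
  · funext i
    rw [Matrix.mulVec_diagonal, mul_comm, Pi.coe_exp]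
    rfl
  · funext i
    rw [Matrix.mulVec_diagonal, mul_comm, Pi.coe_exp, expMu, neg_expMu_arg]

end Diagonal

end SineGordon

namespace SineGordon

/-! ### Lower triangular Toeplitz matrices -/

section Toeplitz

variable {R : Type*} [CommRing R] {n : ℕ}

/-- The lower triangular Toeplitz matrix with first column `a 0, …, a n`. -/
def toep (n : ℕ) (a : ℕ → R) : Matrix (Fin (n + 1)) (Fin (n + 1)) R :=
  Matrix.of fun i j => if (j : ℕ) ≤ i then a ((i : ℕ) - j) else 0

theorem toep_congr {a b : ℕ → R} (h : ∀ m ≤ n, a m = b m) : toep n a = toep n b := by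
  ext i j
  simp only [toep, Matrix.of_apply]
  split_ifs
  · exact h _ (by omega)
  · rfl

theorem toep_mulVec (a : ℕ → R) (b : ℕ → R) (i : Fin (n + 1)) :
    (toep n a *ᵥ fun j => b j) i = ∑ m ∈ Finset.range ((i : ℕ) + 1), b m * a ((i : ℕ) - m) := by
  simp only [Matrix.mulVec, dotProduct, toep, Matrix.of_apply]
  rw [Fin.sum_univ_eq_sum_range (fun j => (if j ≤ (i : ℕ) then a ((i : ℕ) - j) else 0) * b j)]
  refine Eq.trans (Finset.sum_subset (s₁ := Finset.range ((i : ℕ) + 1))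
    (Finset.range_subset_range.2 (by omega)) fun m _ hm => ?_).symm ?_
  · rw [Finset.mem_range, not_lt] at hm
    rw [if_neg (by omega), zero_mul]
  · refine Finset.sum_congr rfl fun m hm => ?_
    rw [Finset.mem_range] at hm
    rw [if_pos (by omega), mul_comm]

theorem toep_mul (a b : ℕ → R) :
    toep n a * toep n b =
      toep n fun k => ∑ m ∈ Finset.range (k + 1), b m * a (k - m) := by
  ext i l
  have h := toep_mulVec (n := n) a (fun j => if (l : ℕ) ≤ j then b (j - l) else 0) i
  refine Eq.trans ?_ (h.trans ?_)
  · rfl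
  · rw [toep, Matrix.of_apply]
    split_ifs with hl
    · have h1 : (i : ℕ) + 1 = l + ((i : ℕ) - l + 1) := by omega
      rw [h1, Finset.sum_range_add, Finset.sum_eq_zero, zero_add]
      · refine Finset.sum_congr rfl fun m _ => ?_
        rw [if_pos (by omega)]
        congr 2 <;> omega
      · intro m hm
        rw [Finset.mem_range] at hm
        rw [if_neg (by omega), zero_mul]
    · refine Finset.sum_eq_zero fun m hm => ?_
      rw [Finset.mem_range] at hm
      rw [if_neg (by omega), zero_mul]

theorem toep_commute (a b : ℕ → R) : Commute (toep n a) (toep n b) := by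
  rw [Commute, SemiconjBy, toep_mul, toep_mul]
  refine toep_congr fun k _ => ?_
  rw [← Finset.sum_range_reflect]
  refine Finset.sum_congr rfl fun m hm => ?_
  rw [Finset.mem_range] at hm
  rw [mul_comm]
  congr 2
  omega

/-- The commutator with `diag(0, 1, …, n)` is the Euler derivation. -/
theorem diagonal_commutator_toep (a : ℕ → R) :
    Matrix.diagonal (fun i : Fin (n + 1) => ((i : ℕ) : R)) * toep n a -
      toep n a * Matrix.diagonal (fun i : Fin (n + 1) => ((i : ℕ) : R)) =
      toep n fun m => (m : R) * a m := by
  ext i j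
  rw [Matrix.sub_apply, Matrix.diagonal_mul, Matrix.mul_diagonal]
  simp only [toep, Matrix.of_apply]
  split_ifs with h
  · rw [Nat.cast_sub h]; ring
  · ring

theorem exists_toep_mulVec_one (c : Fin (n + 1) → R) :
    ∃ a : ℕ → R, toep n a *ᵥ (fun _ => 1) = c := by
  let c' : ℕ → R := fun m => if h : m < n + 1 then c ⟨m, h⟩ else 0
  -- Applied to `(1, …, 1)`, a Toeplitz matrix yields the partial sums of `a`, so `a` is taken as
  -- the difference sequence of `c`.
  let a : ℕ → R := fun m => if m = 0 then c' 0 else c' m - c' (m - 1)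
  have hs : ∀ i : ℕ, ∑ m ∈ Finset.range (i + 1), a m = c' i := by
    intro i
    induction i with
    | zero => simp [a]
    | succ i ih => rw [Finset.sum_range_succ, ih]; simp [a]
  refine ⟨a, funext fun i => ?_⟩
  have h := toep_mulVec (n := n) a (fun _ => 1) i
  rw [h]
  simp only [one_mul]
  have h2 := Finset.sum_range_reflect a ((i : ℕ) + 1)
  simp only [Nat.add_sub_cancel] at h2
  rw [h2, hs]
  exact dif_pos i.2

end Toeplitz

/-! ### A commutator with an exponential -/

section Derivation

open scoped Matrix.Norms.Operator

variable {𝕜 : Type*} [RCLike 𝕜] {ι : Type*} [Fintype ι] [DecidableEq ι]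

/-- If the commutator `[D, M]` commutes with `M`, then `[D, exp M] = [D, M] exp M`. -/
theorem commutator_exp {D M X : Matrix ι ι 𝕜} (hX : D * M - M * D = X) (hc : Commute X M) :
    D * NormedSpace.exp M - NormedSpace.exp M * D = X * NormedSpace.exp M := by
  -- The derivative of `exp(-sM) D exp(sM)` is the constant `X`, because `X` commutes with `M`;
  -- hence `Y` is constant.
  let Y : ℝ → Matrix ι ι 𝕜 := fun s =>
    NormedSpace.exp (s • (-M)) * D * NormedSpace.exp (s • M) - s • X
  have hY : ∀ s, HasDerivAt Y 0 s := by
    intro s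
    have h1 : HasDerivAt (fun u : ℝ => NormedSpace.exp (u • (-M)))
        (NormedSpace.exp (s • (-M)) * -M) s := hasDerivAt_exp_smul_const (-M) s
    have h2 : HasDerivAt (fun u : ℝ => NormedSpace.exp (u • M))
        (M * NormedSpace.exp (s • M)) s := hasDerivAt_exp_smul_const' M s
    have h3 := ((h1.mul_const D).mul h2).sub ((hasDerivAt_id s).smul_const X)
    refine h3.congr_deriv ?_
    have h4 : X * NormedSpace.exp (s • M) = NormedSpace.exp (s • M) * X :=
      (hc.smul_right s).exp_right.eq
    have h5 : NormedSpace.exp (s • (-M)) * NormedSpace.exp (s • M) = 1 := by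
      rw [← Matrix.exp_add_of_commute _ _
        (((Commute.refl M).neg_left.smul_left s).smul_right s), smul_neg, neg_add_cancel]
      exact NormedSpace.exp_zero
    have h6 : NormedSpace.exp (s • (-M)) * (X * NormedSpace.exp (s • M)) = X := by
      rw [h4, ← mul_assoc, h5, one_mul]
    rw [one_smul, sub_eq_zero]
    refine Eq.trans ?_ h6
    rw [← hX]
    simp only [sub_mul, mul_sub, mul_neg, neg_mul, mul_assoc]
    abel
  have h0 : Y 1 = Y 0 :=
    is_const_of_deriv_eq_zero (fun s => (hY s).differentiableAt) (fun s => (hY s).deriv) 1 0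
  have h5 : NormedSpace.exp M * NormedSpace.exp (-M) = 1 := by
    rw [← Matrix.exp_add_of_commute _ _ (Commute.refl M).neg_right, add_neg_cancel]
    exact NormedSpace.exp_zero
  have hD : NormedSpace.exp (-M) * D * NormedSpace.exp M = D + X := by
    have h7 : NormedSpace.exp (0 : Matrix ι ι 𝕜) = 1 := NormedSpace.exp_zero
    simp only [Y, one_smul, zero_smul, h7, one_mul, mul_one, sub_zero] at h0
    exact sub_eq_iff_eq_add.1 h0
  have h8 : NormedSpace.exp M * (NormedSpace.exp (-M) * D * NormedSpace.exp M) =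
      D * NormedSpace.exp M := by
    rw [← mul_assoc, ← mul_assoc, h5, one_mul]
  have h9 : X * NormedSpace.exp M = NormedSpace.exp M * X := hc.exp_right.eq
  rw [← h8, hD, h9, mul_add, add_sub_cancel_left]

end Derivation

/-! ### Taylor coefficients as Toeplitz matrices -/

section Taylor

variable {𝕜 : Type*} [RCLike 𝕜] {n : ℕ} {k : 𝕜}

/-- The Taylor coefficient of `F` of order `m` at `k`. -/
noncomputable def tcoef (F : 𝕜 → 𝕜) (k : 𝕜) (m : ℕ) : 𝕜 :=
  iteratedDeriv m F k / (Nat.factorial m : 𝕜)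

theorem tcoef_zero (F : 𝕜 → 𝕜) (k : 𝕜) : tcoef F k 0 = F k := by simp [tcoef]

theorem tcoef_congr {F G : 𝕜 → 𝕜} (h : F =ᶠ[𝓝 k] G) (m : ℕ) : tcoef F k m = tcoef G k m := by
  rw [tcoef, tcoef, h.iteratedDeriv_eq]

theorem tcoef_mul {F G : 𝕜 → 𝕜} {m : ℕ} (hF : ContDiffAt 𝕜 m F k) (hG : ContDiffAt 𝕜 m G k) :
    tcoef (fun κ => F κ * G κ) k m =
      ∑ i ∈ Finset.range (m + 1), tcoef F k i * tcoef G k (m - i) := by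
  rw [tcoef, iteratedDeriv_fun_mul hF hG, Finset.sum_div]
  refine Finset.sum_congr rfl fun i hi => ?_
  rw [Finset.mem_range] at hi
  have h := Nat.choose_mul_factorial_mul_factorial (show i ≤ m by omega)
  have h' : ((m.choose i : ℕ) : 𝕜) * (i.factorial : 𝕜) * ((m - i).factorial : 𝕜) =
    (m.factorial : 𝕜) := by exact_mod_cast h
  have h1 : (i.factorial : 𝕜) ≠ 0 := by exact_mod_cast i.factorial_ne_zero
  have h2 : ((m - i).factorial : 𝕜) ≠ 0 := by exact_mod_cast (m - i).factorial_ne_zero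
  have h3 : (m.factorial : 𝕜) ≠ 0 := by exact_mod_cast m.factorial_ne_zero
  rw [tcoef, tcoef, div_mul_div_comm, div_eq_div_iff h3 (mul_ne_zero h1 h2), ← h']
  ring

theorem succ_mul_tcoef_succ (F : 𝕜 → 𝕜) (k : 𝕜) (m : ℕ) :
    ((m + 1 : ℕ) : 𝕜) * tcoef F k (m + 1) = tcoef (deriv F) k m := by
  have h1 : ((m + 1 : ℕ) : 𝕜) ≠ 0 := by exact_mod_cast m.succ_ne_zero
  rw [tcoef, tcoef, iteratedDeriv_succ', Nat.factorial_succ, Nat.cast_mul, mul_div_assoc',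
    mul_div_mul_left _ _ h1]

/-- The action of multiplication by `F` on Taylor coefficients at `k`. -/
noncomputable def tay (n : ℕ) (k : 𝕜) (F : 𝕜 → 𝕜) : Matrix (Fin (n + 1)) (Fin (n + 1)) 𝕜 :=
  toep n (tcoef F k)

theorem tay_mul {F G : 𝕜 → 𝕜} (hF : ContDiffAt 𝕜 n F k) (hG : ContDiffAt 𝕜 n G k) :
    tay n k F * tay n k G = tay n k (fun κ => G κ * F κ) := by
  rw [tay, tay, tay, toep_mul]
  refine toep_congr fun m hm => ?_
  have h : ((m : ℕ) : WithTop ℕ∞) ≤ n := by exact_mod_cast hm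
  rw [tcoef_mul (hG.of_le h) (hF.of_le h)]

theorem tay_mulVec {F c : 𝕜 → 𝕜} (hF : ContDiffAt 𝕜 n F k) (hc : ContDiffAt 𝕜 n c k) :
    (tay n k F *ᵥ fun j : Fin (n + 1) => tcoef c k j) =
      fun j : Fin (n + 1) => tcoef (fun κ => c κ * F κ) k j := by
  funext i
  have h : (((i : ℕ) : ℕ) : WithTop ℕ∞) ≤ n := by exact_mod_cast (by omega : (i : ℕ) ≤ n)
  rw [tay, toep_mulVec, tcoef_mul (hc.of_le h) (hF.of_le h)]

/-- The Taylor expansion of the identity function at `k` is `k + (κ - k)`. -/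
theorem jordan_eq_tay (n : ℕ) (k : 𝕜) : jordan n k = tay n k (fun κ => κ) := by
  ext i j
  simp only [jordan, tay, toep, Matrix.of_apply, tcoef, iteratedDeriv_fun_id]
  rcases lt_trichotomy (i : ℕ) (j : ℕ) with h | h | h
  · rw [if_neg (by rintro rfl; omega), if_neg (by omega), if_neg (by omega)]
  · have : i = j := Fin.ext h
    subst this
    simp
  · rw [if_neg (by rintro rfl; omega), if_pos h.le, if_neg (show ¬(i : ℕ) - j = 0 by omega)]
    by_cases h1 : (i : ℕ) = j + 1
    · rw [if_pos h1, if_pos (show (i : ℕ) - j = 1 by omega), h1]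
      simp
    · rw [if_neg h1, if_neg (show ¬(i : ℕ) - j = 1 by omega), zero_div]

theorem tay_one (n : ℕ) (k : 𝕜) : tay n k (fun _ => 1) = 1 := by
  ext i j
  simp only [tay, toep, Matrix.of_apply, tcoef, iteratedDeriv_const, Matrix.one_apply]
  rcases lt_trichotomy (i : ℕ) (j : ℕ) with h | h | h
  · rw [if_neg (by omega), if_neg (by rintro rfl; omega)]
  · have : i = j := Fin.ext h
    subst this
    simp
  · rw [if_pos h.le, if_neg (by omega), if_neg (by rintro rfl; omega), zero_div]

theorem jordan_mul_tay_inv (hk : k ≠ 0) : jordan n k * tay n k (fun κ => κ⁻¹) = 1 := by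
  have h1 : ContDiffAt 𝕜 n (fun κ : 𝕜 => κ) k := contDiffAt_id
  have h2 : ContDiffAt 𝕜 n (fun κ : 𝕜 => κ⁻¹) k := contDiffAt_inv 𝕜 hk
  rw [jordan_eq_tay, tay_mul h1 h2, ← tay_one n k, tay, tay]
  refine toep_congr fun m _ => tcoef_congr ?_ m
  filter_upwards [isOpen_ne.mem_nhds hk] with κ hκ
  exact inv_mul_cancel₀ hκ

theorem isUnit_det_jordan (hk : k ≠ 0) : IsUnit (jordan n k).det :=
  Matrix.isUnit_det_of_right_inverse (jordan_mul_tay_inv hk)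

/-- The function `μ(κ) = -κ x - t / (4 κ)`. -/
noncomputable def muFun (x t : ℝ) (κ : 𝕜) : 𝕜 := -κ * (x : 𝕜) - (t : 𝕜) / (4 * κ)

theorem analyticAt_muFun (hk : k ≠ 0) (x t : ℝ) : AnalyticAt 𝕜 (muFun x t) k := by
  unfold muFun
  refine (analyticAt_id.neg.mul analyticAt_const).sub
    (analyticAt_const.div (analyticAt_const.mul analyticAt_id) ?_)
  simpa using hk

theorem tay_muFun (hk : k ≠ 0) (x t : ℝ) :
    tay n k (muFun x t) = -(x • jordan n k) - (t / 4) • (jordan n k)⁻¹ := by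
  rw [Matrix.inv_eq_right_inv (jordan_mul_tay_inv hk), jordan_eq_tay]
  have h : ∀ m ≤ n, tcoef (muFun x t) k m =
      -(x : 𝕜) * tcoef (fun κ => κ) k m + -((t : 𝕜) / 4) * tcoef (fun κ => κ⁻¹) k m := by
    intro m _
    have h1 : muFun x t = fun κ : 𝕜 => (-(x : 𝕜)) * κ + (-((t : 𝕜) / 4)) * κ⁻¹ := by
      funext κ
      rw [muFun, div_mul_eq_div_div, div_eq_mul_inv _ κ]
      ring
    have h2 : ContDiffAt 𝕜 m (fun κ : 𝕜 => (-(x : 𝕜)) * κ) k := contDiffAt_const.mul contDiffAt_id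
    have h3 : ContDiffAt 𝕜 m (fun κ : 𝕜 => (-((t : 𝕜) / 4)) * κ⁻¹) k :=
      contDiffAt_const.mul (contDiffAt_inv 𝕜 hk)
    rw [h1, tcoef, iteratedDeriv_fun_add h2 h3, iteratedDeriv_const_mul_field,
      iteratedDeriv_const_mul_field, tcoef, tcoef]
    ring
  rw [tay, toep_congr h]
  ext i j
  simp only [tay, toep, Matrix.of_apply, Matrix.sub_apply, Matrix.neg_apply, Matrix.smul_apply,
    RCLike.real_smul_eq_coe_mul]
  push_cast
  split_ifs <;> ring

theorem tay_neg (F : 𝕜 → 𝕜) : tay n k (fun κ => -F κ) = -tay n k F := by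
  ext i j
  simp only [tay, toep, Matrix.of_apply, tcoef, Matrix.neg_apply, iteratedDeriv_fun_neg]
  split_ifs <;> ring

end Taylor

/-! ### Exponentials of Toeplitz matrices and explicit `φ` for a Jordan block -/

section ExpTaylor

open scoped Matrix.Norms.Operator

variable {𝕜 : Type*} [RCLike 𝕜] {n : ℕ} {k : 𝕜} {g : 𝕜 → 𝕜}

theorem analyticAt_exp_comp (hg : AnalyticAt 𝕜 g k) :
    AnalyticAt 𝕜 (fun κ => NormedSpace.exp (g κ)) k :=
  (NormedSpace.exp_analytic (𝕂 := 𝕜) (g k)).comp hg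

/-- The equation `(e^g)' = e^g g'` in Taylor coefficients; the factor `m - i` makes the term `i = m`
vanish. -/
theorem mul_tcoef_exp (hg : AnalyticAt 𝕜 g k) (m : ℕ) :
    (m : 𝕜) * tcoef (fun κ => NormedSpace.exp (g κ)) k m =
      ∑ i ∈ Finset.range (m + 1),
        tcoef (fun κ => NormedSpace.exp (g κ)) k i * (((m - i : ℕ) : 𝕜) * tcoef g k (m - i)) := by
  cases m with
  | zero => simp
  | succ m =>
    have h1 : deriv (fun κ => NormedSpace.exp (g κ)) =ᶠ[𝓝 k]
        fun κ => NormedSpace.exp (g κ) * deriv g κ := by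
      filter_upwards [hg.eventually_analyticAt] with κ hκ
      exact ((hasDerivAt_exp (x := g κ)).comp κ hκ.differentiableAt.hasDerivAt).deriv
    rw [succ_mul_tcoef_succ, tcoef_congr h1, tcoef_mul (analyticAt_exp_comp hg).contDiffAt
      hg.deriv.contDiffAt, Finset.sum_range_succ _ (m + 1)]
    simp only [tsub_self, Nat.cast_zero, zero_mul, mul_zero, add_zero]
    refine Finset.sum_congr rfl fun i hi => ?_
    rw [Finset.mem_range] at hi
    have : m + 1 - i = (m - i) + 1 := by omega
    rw [this, succ_mul_tcoef_succ]

/-- Both sides solve the same Euler equation `[D, Z] = X Z` with `D = diag(0, …, n)`. Their quotient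
`H` commutes with `D`, so it is diagonal; it also commutes with the Jordan block, so it is scalar;
its corner entry is `1`. -/
theorem exp_tay (hg : AnalyticAt 𝕜 g k) :
    NormedSpace.exp (tay n k g) = tay n k (fun κ => NormedSpace.exp (g κ)) := by
  set M := tay n k g with hM
  set G := tay n k (fun κ => NormedSpace.exp (g κ)) with hG
  set D : Matrix (Fin (n + 1)) (Fin (n + 1)) 𝕜 :=
    Matrix.diagonal (fun i : Fin (n + 1) => ((i : ℕ) : 𝕜)) with hD
  set X := toep n (fun m => (m : 𝕜) * tcoef g k m) with hX
  have hXM : D * M - M * D = X := diagonal_commutator_toep _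
  have hXG : D * G - G * D = X * G := by
    rw [hG, tay, diagonal_commutator_toep, hX, toep_mul]
    exact toep_congr fun m _ => mul_tcoef_exp hg m
  have hcM : Commute X M := toep_commute _ _
  have hXe : D * NormedSpace.exp (-M) - NormedSpace.exp (-M) * D = -X * NormedSpace.exp (-M) :=
    commutator_exp (by rw [← hXM]; noncomm_ring) hcM.neg_left.neg_right
  have hcX : X * NormedSpace.exp (-M) = NormedSpace.exp (-M) * X := hcM.neg_right.exp_right.eq
  set H := NormedSpace.exp (-M) * G with hH
  have hDH : D * H = H * D := by
    rw [neg_mul, hcX] at hXe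
    rw [hH]
    have e1 := congrArg (fun Z => Z * G) hXe
    have e2 := congrArg (fun Z => NormedSpace.exp (-M) * Z) hXG
    simp only [sub_mul, mul_sub, neg_mul, mul_assoc] at e1 e2
    rw [mul_assoc]
    have e3 := congrArg₂ (· + ·) e1 e2
    simp only [sub_add_sub_cancel, neg_add_cancel] at e3
    exact sub_eq_zero.1 e3
  have hoff : ∀ i j, i ≠ j → H i j = 0 := by
    intro i j hij
    have e := congrFun (congrFun hDH i) j
    rw [hD, Matrix.diagonal_mul, Matrix.mul_diagonal] at e
    have h1 : ((i : ℕ) : 𝕜) - ((j : ℕ) : 𝕜) ≠ 0 := by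
      rw [sub_ne_zero]
      exact fun h => hij (Fin.ext (by exact_mod_cast h))
    have h2 : (((i : ℕ) : 𝕜) - ((j : ℕ) : 𝕜)) * H i j = 0 := by linear_combination e
    exact (mul_eq_zero.1 h2).resolve_left h1
  have hdiag : H = Matrix.diagonal fun i => H i i := by
    ext i j
    by_cases h : i = j
    · subst h; simp
    · rw [hoff i j h, Matrix.diagonal_apply_ne _ h]
  have hcK : jordan n k * H = H * jordan n k := by
    rw [jordan_eq_tay]
    have h1 : Commute (tay n k fun κ => κ) M := toep_commute _ _
    have h2 : Commute (tay n k fun κ => κ) G := toep_commute _ _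
    have h3 : Commute (tay n k fun κ => κ) (NormedSpace.exp (-M)) := h1.neg_right.exp_right
    exact (h3.mul_right h2).eq
  -- The subdiagonal entries `1` of the Jordan block link consecutive diagonal entries of `H`.
  have hstep : ∀ m : ℕ, ∀ hm : m + 1 < n + 1, H ⟨m + 1, hm⟩ ⟨m + 1, hm⟩ =
      H ⟨m, by omega⟩ ⟨m, by omega⟩ := by
    intro m hm
    have e := congrFun (congrFun hcK ⟨m + 1, hm⟩) ⟨m, by omega⟩
    rw [hdiag, Matrix.mul_diagonal, Matrix.diagonal_mul] at e
    simpa [jordan] using e.symm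
  have h00 : H 0 0 = 1 := by
    -- Row `0` of a lower triangular matrix has only its corner entry, so `E₀₀` reduces `-M` to the
    -- scalar `-g k`.
    have hs : SemiconjBy (Matrix.single (0 : Fin (n + 1)) (0 : Fin (n + 1)) (1 : 𝕜)) (-M)
        (Matrix.diagonal fun _ => -g k) := by
      ext i j
      by_cases hi : i = 0
      · subst hi
        rw [Matrix.single_mul_apply_same, Matrix.diagonal_mul, one_mul, Matrix.neg_apply, hM, tay,
          toep, Matrix.of_apply]
        by_cases hj : j = 0
        · subst hj; simp [tcoef_zero]
        · have : (j : ℕ) ≠ 0 := fun h => hj (Fin.ext h)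
          rw [if_neg (by simpa using this)]
          simp [Ne.symm hj]
      · rw [Matrix.single_mul_apply_of_ne _ _ _ _ _ hi, Matrix.diagonal_mul]
        simp [Ne.symm hi]
    let _ : NormedAlgebra ℚ (Matrix (Fin (n + 1)) (Fin (n + 1)) 𝕜) :=
      NormedAlgebra.restrictScalars ℚ ℝ _
    have he := hs.exp_right.eq
    have he' : Matrix.single (0 : Fin (n + 1)) (0 : Fin (n + 1)) (1 : 𝕜) *
        NormedSpace.exp (-M) = Matrix.diagonal (fun _ => NormedSpace.exp (-g k)) *
          Matrix.single (0 : Fin (n + 1)) (0 : Fin (n + 1)) (1 : 𝕜) := by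
      refine he.trans ?_
      congr 1
      refine (Matrix.exp_diagonal _).trans (congrArg Matrix.diagonal (funext fun i => ?_))
      rw [Pi.coe_exp]
    have e' : Matrix.single (0 : Fin (n + 1)) (0 : Fin (n + 1)) (1 : 𝕜) * H =
        Matrix.diagonal (fun _ => NormedSpace.exp (-g k)) *
          (Matrix.single (0 : Fin (n + 1)) (0 : Fin (n + 1)) (1 : 𝕜) * G) := by
      rw [hH, ← mul_assoc, he', mul_assoc]
    have e := congrFun (congrFun e' 0) 0
    rw [Matrix.single_mul_apply_same, Matrix.diagonal_mul, Matrix.single_mul_apply_same,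
      one_mul, one_mul, hG, tay, toep, Matrix.of_apply, if_pos le_rfl] at e
    rw [e]
    simp only [Fin.val_zero, tsub_self, tcoef_zero]
    rw [← NormedSpace.exp_add, neg_add_cancel, NormedSpace.exp_zero]
  have hone : ∀ m : ℕ, ∀ hm : m < n + 1, H ⟨m, hm⟩ ⟨m, hm⟩ = 1 := by
    intro m
    induction m with
    | zero => intro _; exact h00
    | succ m ih => intro hm; rw [hstep m hm, ih]
  have hH1 : H = 1 := by
    rw [hdiag, ← Matrix.diagonal_one]
    congr 1
    funext i
    exact hone i i.2
  have h5 : NormedSpace.exp M * NormedSpace.exp (-M) = 1 := by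
    rw [← Matrix.exp_add_of_commute _ _ (Commute.refl M).neg_right, add_neg_cancel]
    exact NormedSpace.exp_zero
  calc NormedSpace.exp M = NormedSpace.exp M * H := by rw [hH1, mul_one]
    _ = G := by rw [hH, ← mul_assoc, h5, one_mul]

/-- `μ` is odd in `k`, so the block `-K` gives the exponential of `-μ`; multiplying by the resulting
Toeplitz matrix is the Leibniz rule. -/
theorem phi_blockA_jordan (hk : k ≠ 0) {c d : 𝕜 → 𝕜} (hc : ContDiffAt 𝕜 n c k)
    (hd : ContDiffAt 𝕜 n d k) (x t : ℝ) :
    phi (blockA (jordan n k)) (taylorVec n k c d) x t = phiJordan n k c d x t := by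
  have hμ := analyticAt_muFun hk x t
  have h1 := exp_tay (n := n) hμ
  have h2 := exp_tay (n := n) hμ.neg
  have h3 : (tay n k (-muFun x t)) = -tay n k (muFun x t) := tay_neg _
  rw [h3] at h2
  rw [taylorVec, phi_blockA_append (isUnit_det_jordan hk), ← tay_muFun hk, phiJordan]
  congr 1
  · rw [h1]
    exact tay_mulVec (analyticAt_exp_comp hμ).contDiffAt hc
  · rw [h2]
    have h4 : (fun κ : 𝕜 => d κ * expMu x t (-κ)) =
        fun κ => d κ * NormedSpace.exp ((-muFun x t) κ) := by
      funext κ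
      rw [expMu, neg_expMu_arg]
      rfl
    rw [h4]
    exact tay_mulVec (analyticAt_exp_comp hμ.neg).contDiffAt hd

end ExpTaylor

/-! ### Gauge freedom in `C⁺` -/

section Gauge

variable {𝕜 : Type*} [RCLike 𝕜]

/-- A matrix commuting with `A` passes through the exponentials and through every power of `A`, and
so factors out of the whole Wronskian matrix on the left. -/
theorem doubleWronskian_mulVec {N : ℕ} (p : ℕ) {A S : Matrix (Fin N) (Fin N) 𝕜}
    (hA : IsUnit A.det) (hS : Commute S A) (C D : Fin N → 𝕜) (x t : ℝ) :
    doubleWronskian p (phi A (S *ᵥ C)) (psi A (S *ᵥ D)) x t =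
      S.det * doubleWronskian p (phi A C) (psi A D) x t := by
  rw [doubleWronskian_eq_det p hA, doubleWronskian_eq_det p hA, ← Matrix.det_mul]
  congr 1
  have h1 : phi A (S *ᵥ C) x t = S *ᵥ phi A C x t := by
    change expMat A x t *ᵥ (S *ᵥ C) = S *ᵥ (expMat A x t *ᵥ C)
    rw [Matrix.mulVec_mulVec, Matrix.mulVec_mulVec, (commute_expMat hA hS x t).eq]
  have h2 : psi A (S *ᵥ D) x t = S *ᵥ psi A D x t := by
    rw [psi_eq_phi_neg hA, psi_eq_phi_neg hA]
    change expMat (-A) x t *ᵥ (S *ᵥ D) = S *ᵥ (expMat (-A) x t *ᵥ D)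
    rw [Matrix.mulVec_mulVec, Matrix.mulVec_mulVec,
      (commute_expMat (isUnit_det_neg hA) hS.neg_right x t).eq]
  rw [wMat, wMat, h1, h2]
  ext i j
  change _ = (S *ᵥ fun l => colMat p A (phi A C x t) (psi A D x t) l j) i
  simp only [colMat, Matrix.of_apply]
  split_ifs
  · change _ = (S *ᵥ ((-A) ^ (j : ℕ) *ᵥ phi A C x t)) i
    rw [Matrix.mulVec_mulVec, Matrix.mulVec_mulVec, (hS.neg_right.pow_right _).eq]
  · change _ = (S *ᵥ (A ^ ((j : ℕ) - p) *ᵥ psi A D x t)) i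
    rw [Matrix.mulVec_mulVec, Matrix.mulVec_mulVec, (hS.pow_right _).eq]

variable {n : ℕ}

/-- Diagonal matrices commute with a diagonal `K`, Toeplitz matrices with a Jordan block; each
family carries `(1, …, 1)` to any vector. -/
theorem exists_commute_mulVec_one {K : Matrix (Fin (n + 1)) (Fin (n + 1)) 𝕜}
    (hK : (∃ k : Fin (n + 1) → 𝕜, (∀ i, k i ≠ 0) ∧ K = Matrix.diagonal k) ∨
      (∃ k : 𝕜, k ≠ 0 ∧ K = jordan n k)) :
    IsUnit K.det ∧ ∀ c : Fin (n + 1) → 𝕜, ∃ S, Commute S K ∧ S *ᵥ (fun _ => 1) = c := by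
  rcases hK with ⟨k, hk, rfl⟩ | ⟨k, hk, rfl⟩
  · refine ⟨isUnit_det_diagonal hk, fun c => ⟨Matrix.diagonal c, ?_, ?_⟩⟩
    · rw [Commute, SemiconjBy, Matrix.diagonal_mul_diagonal, Matrix.diagonal_mul_diagonal]
      simp_rw [mul_comm]
    · funext i
      rw [Matrix.mulVec_diagonal, mul_one]
  · refine ⟨isUnit_det_jordan hk, fun c => ?_⟩
    obtain ⟨a, ha⟩ := exists_toep_mulVec_one c
    refine ⟨toep n a, ?_, ha⟩
    rw [jordan_eq_tay]
    exact toep_commute _ _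

theorem qW_gauge {K : Matrix (Fin (n + 1)) (Fin (n + 1)) 𝕜}
    (hK : (∃ k : Fin (n + 1) → 𝕜, (∀ i, k i ≠ 0) ∧ K = Matrix.diagonal k) ∨
      (∃ k : 𝕜, k ≠ 0 ∧ K = jordan n k)) (C : Fin ((n + 1) + (n + 1)) → 𝕜) {x t : ℝ}
    (h : (x, t) ∈ regularSet (phi (blockA K) C) (psi (blockA K) (blockTMinus 𝕜 n *ᵥ C))) :
    (x, t) ∈ regularSet (phi (blockA K) (fun _ => 1))
        (psi (blockA K) (blockTMinus 𝕜 n *ᵥ (fun _ => 1))) ∧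
      qW (phi (blockA K) (fun _ => 1)) (psi (blockA K) (blockTMinus 𝕜 n *ᵥ (fun _ => 1))) x t =
        qW (phi (blockA K) C) (psi (blockA K) (blockTMinus 𝕜 n *ᵥ C)) x t := by
  obtain ⟨hdet, hex⟩ := exists_commute_mulVec_one hK
  obtain ⟨S₁, hS₁, h₁⟩ := hex fun i => C (Fin.castAdd (n + 1) i)
  obtain ⟨S₂, hS₂, h₂⟩ := hex fun i => C (Fin.natAdd (n + 1) i)
  have hA := isUnit_det_blockA hdet
  have hC : C = blocks S₁ 0 0 S₂ *ᵥ fun _ => 1 := by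
    have h1 : (fun _ => 1 : Fin ((n + 1) + (n + 1)) → 𝕜) =
        Fin.append (fun _ => 1) (fun _ => 1) := by
      funext i
      refine Fin.addCases (fun i => ?_) (fun i => ?_) i
      · rw [Fin.append_left]
      · rw [Fin.append_right]
    rw [h1, blocks_diag_mulVec_append, h₁, h₂]
    exact (Fin.append_castAdd_natAdd (f := C)).symm
  have hSA : Commute (blocks S₁ 0 0 S₂) (blockA K) := by
    rw [Commute, SemiconjBy, blockA, blocks_mul, blocks_mul]
    simp [hS₁.eq, hS₂.eq]
  have hST : blockTMinus 𝕜 n * blocks S₁ 0 0 S₂ = blocks S₁ 0 0 S₂ * blockTMinus 𝕜 n := by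
    rw [blockTMinus, blocks_mul, blocks_mul]
    simp
  have hTC : blockTMinus 𝕜 n *ᵥ C = blocks S₁ 0 0 S₂ *ᵥ (blockTMinus 𝕜 n *ᵥ fun _ => 1) := by
    rw [hC, Matrix.mulVec_mulVec, hST, Matrix.mulVec_mulVec]
  rw [hTC] at h ⊢
  rw [hC] at h ⊢
  have hw := fun p => doubleWronskian_mulVec p hA hSA (fun _ => 1)
    (blockTMinus 𝕜 n *ᵥ fun _ => 1) x t
  simp only [regularSet, Set.mem_ofPred_eq, fW, hw] at h ⊢
  -- `f` for `C` is `det S` times `f` for `(1, …, 1)`, so `f ≠ 0` makes both factors nonzero;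
  -- invertibility of `S` comes for free.
  refine ⟨right_ne_zero_of_mul h, ?_⟩
  simp only [qW, hW, fW, hw]
  rw [mul_left_comm, mul_div_mul_left _ _ (left_ne_zero_of_mul h)]

end Gauge

end SineGordon

/-! ### The theorem -/

theorem theorem6 {𝕜 : Type*} [RCLike 𝕜] :
    -- The reduction of the system.
    (∀ σ : ℝ, σ = 1 ∨ σ = -1 → ∀ q : ℝ → ℝ → 𝕜, IsC2On Set.univ q →
      -- The integro-differential form, with `s = ∂ₓ⁻¹ (q r)_t + 1/2`.
      (HasAux q (reduction σ q) →
        (σ = -1 → ∀ x t : ℝ, auxS q (reduction σ q) (-x) (-t) = auxS q (reduction σ q) x t) ∧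
        (IsAKNSIntSol q (reduction σ q) ↔
          IsAKNSSol Set.univ q (reduction σ q) (auxS q (reduction σ q))) ∧
        (σ = 1 → (IsAKNSIntSol q (reduction σ q) ↔
          IsSGSol Set.univ q (auxS q (reduction σ q)))) ∧
        (σ = -1 → (IsAKNSIntSol q (reduction σ q) ↔
          IsNonlocalSGSol Set.univ q (auxS q (reduction σ q))))) ∧
      -- The form with an auxiliary function `s`.
      (∀ s : ℝ → ℝ → 𝕜,
        (σ = 1 → (IsAKNSSol Set.univ q (reduction σ q) s ↔ IsSGSol Set.univ q s)) ∧
        (σ = -1 → IsAKNSSol Set.univ q (reduction σ q) s → IsNonlocalSGSol Set.univ q s) ∧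
        (σ = -1 → (∀ x t : ℝ, s (-x) (-t) = s x t) → IsNonlocalSGSol Set.univ q s →
          IsAKNSSol Set.univ q (reduction σ q) s))) ∧
    -- The reduction of the double Wronskians, and the solutions.
    (∀ (σ : ℝ), σ = 1 ∨ σ = -1 → ∀ (n : ℕ)
      (A T : Matrix (Fin ((n + 1) + (n + 1))) (Fin ((n + 1) + (n + 1))) 𝕜)
      (C : Fin ((n + 1) + (n + 1)) → 𝕜), IsUnit A.det → Admissible σ A T →
      ∀ φ ψ : ℝ → ℝ → Fin ((n + 1) + (n + 1)) → 𝕜, φ = phi A C → ψ = psi A (T.mulVec C) →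
        (∀ x t : ℝ, ψ x t = T.mulVec (φ (σ * x) (σ * t))) ∧
        IsOpen (regularSet φ ψ) ∧
        (∀ x t : ℝ, (σ * x, σ * t) ∈ regularSet φ ψ ↔ (x, t) ∈ regularSet φ ψ) ∧
        (∀ x t : ℝ, (x, t) ∈ regularSet φ ψ →
          rW φ ψ x t = reduction σ (qW φ ψ) x t ∧
          sW φ ψ (σ * x) (σ * t) = sW φ ψ x t) ∧
        IsAKNSSol (regularSet φ ψ) (qW φ ψ) (rW φ ψ) (sW φ ψ) ∧
        (σ = 1 → IsSGSol (regularSet φ ψ) (qW φ ψ) (sW φ ψ)) ∧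
        (σ = -1 → IsNonlocalSGSol (regularSet φ ψ) (qW φ ψ) (sW φ ψ)) ∧
        -- If `f` vanishes nowhere and the boundary condition `s → 1/2` as `|x| → ∞` holds,
        -- then `s = ∂ₓ⁻¹ (q r)_t + 1/2` and the integro-differential form is solved.
        (regularSet φ ψ = Set.univ → HasAux (qW φ ψ) (reduction σ (qW φ ψ)) →
          (∀ t : ℝ, Tendsto (fun x => sW φ ψ x t) atTop (𝓝 (1 / 2)) ∧
            Tendsto (fun x => sW φ ψ x t) atBot (𝓝 (1 / 2))) →
          (∀ x t : ℝ, sW φ ψ x t = auxS (qW φ ψ) (reduction σ (qW φ ψ)) x t) ∧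
          IsAKNSIntSol (qW φ ψ) (reduction σ (qW φ ψ)))) ∧
    -- Block matrices that satisfy the constraints.
    (∀ (n : ℕ) (K : Matrix (Fin (n + 1)) (Fin (n + 1)) 𝕜),
      Admissible 1 (blockA K) (blockTPlus 𝕜 n) ∧
      Admissible (-1) (blockA K) (blockTMinus 𝕜 n)) ∧
    -- Explicit forms of `φ` for diagonal and for Jordan `K`.
    (∀ (n : ℕ) (k c d : Fin (n + 1) → 𝕜), (∀ i, k i ≠ 0) →
      IsUnit (blockA (Matrix.diagonal k)).det ∧
      ∀ x t : ℝ, phi (blockA (Matrix.diagonal k)) (Fin.append c d) x t = phiDiag k c d x t) ∧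
    (∀ (n : ℕ) (k : 𝕜) (c d : 𝕜 → 𝕜), k ≠ 0 → ContDiffAt 𝕜 n c k → ContDiffAt 𝕜 n d k →
      IsUnit (blockA (jordan n k)).det ∧
      ∀ x t : ℝ, phi (blockA (jordan n k)) (taylorVec n k c d) x t = phiJordan n k c d x t) ∧
    -- For `σ = -1`, `C⁺` can be replaced by `(1, …, 1)` without changing `q`.
    (∀ (n : ℕ) (K : Matrix (Fin (n + 1)) (Fin (n + 1)) 𝕜),
      ((∃ k : Fin (n + 1) → 𝕜, (∀ i, k i ≠ 0) ∧ K = Matrix.diagonal k) ∨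
        (∃ k : 𝕜, k ≠ 0 ∧ K = jordan n k)) →
      ∀ C : Fin ((n + 1) + (n + 1)) → 𝕜, ∀ φ ψ φ₁ ψ₁ : ℝ → ℝ → Fin ((n + 1) + (n + 1)) → 𝕜,
        φ = phi (blockA K) C → ψ = psi (blockA K) ((blockTMinus 𝕜 n).mulVec C) →
        φ₁ = phi (blockA K) (fun _ => 1) →
        ψ₁ = psi (blockA K) ((blockTMinus 𝕜 n).mulVec (fun _ => 1)) →
        ∀ x t : ℝ, (x, t) ∈ regularSet φ ψ →
          (x, t) ∈ regularSet φ₁ ψ₁ ∧ qW φ₁ ψ₁ x t = qW φ ψ x t) := by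
  refine ⟨fun σ hσ q hq => ⟨fun ha => ?_, fun s => ⟨?_, ?_, ?_⟩⟩, ?_, ?_, ?_, ?_, ?_⟩
  · have hiff := isAKNSIntSol_iff hq (isC2On_reduction σ hq) ha
    refine ⟨?_, hiff, ?_, ?_⟩
    · rintro rfl x t
      exact auxS_neg q x t
    · rintro rfl
      exact hiff.trans ⟨fun h => h.isSGSol isOpen_univ fun _ _ _ => rfl, fun h => h.isAKNSSol⟩
    · rintro rfl
      exact hiff.trans ⟨fun h => h.isNonlocalSGSol isOpen_univ fun _ _ _ => rfl,
        fun h => h.isAKNSSol (auxS_neg q)⟩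
  · rintro rfl
    exact ⟨fun h => h.isSGSol isOpen_univ fun _ _ _ => rfl, fun h => h.isAKNSSol⟩
  · rintro rfl h
    exact h.isNonlocalSGSol isOpen_univ fun _ _ _ => rfl
  · rintro rfl hs h
    exact h.isAKNSSol hs
  · rintro σ hσ n A T C hA hT φ ψ rfl rfl
    have hsol := isAKNSSol_doubleWronskian (C := C) (D := T.mulVec C) hA
    have hU := isOpen_regularSet (C := C) (D := T.mulVec C) hA
    refine ⟨psi_eq_mulVec_phi (mul_self_of_eq_or hσ) hA hT.mul_eq C, hU,
      mem_regularSet_reflect hσ hA hT, fun x t hx => ⟨rW_eq_reduction hσ hA hT hx,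
      sW_reflect hσ hA hT hx⟩, hsol, ?_, ?_, ?_⟩
    · rintro rfl
      exact hsol.isSGSol hU fun x t hx => rW_eq_reduction hσ hA hT hx
    · rintro rfl
      exact hsol.isNonlocalSGSol hU fun x t hx => rW_eq_reduction hσ hA hT hx
    · intro hV ha hs
      obtain ⟨h1, h2⟩ := sW_eq_auxS hσ hA hT hV ha hs
      exact ⟨fun x t => congrFun (congrFun h1 x) t, h2⟩
  · exact fun n K => ⟨admissible_blockTPlus K, admissible_blockTMinus K⟩
  · exact fun n k c d hk => ⟨isUnit_det_blockA (isUnit_det_diagonal hk),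
      phi_blockA_diagonal hk c d⟩
  · exact fun n k c d hk hc hd => ⟨isUnit_det_blockA (isUnit_det_jordan hk),
      phi_blockA_jordan hk hc hd⟩
  · rintro n K hK C φ ψ φ₁ ψ₁ rfl rfl rfl rfl x t h
    exact qW_gauge hK C h
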